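/- **Model.** There are two arm-types, an optimal one with mean reward $\mu_1$ and an inferior one with mean reward $\mu_2$, where $\Delta:=\mu_1-\mu_2>0$. In each round $t=1,2,\dots$ a decision maker either plays an arm played before or plays a new arm queried from a reservoir. Let $\mathcal J_t$ be the number of reservoir queries up to and including round $t$ ($\mathcal J_0=0$). A new arm queried in round $t$ is optimal with probability $\alpha(t)=g(\mathcal J_{t-1})$ and inferior otherwise, where $g:\{0,1,2,\dots\}\to(0,c]$ is a fixed non-increasing function with $g(0)=c\in(0,1)$. Types are not observed. The $j$-th pull of arm $i$ gives an observed reward $X_{i,j}\in[0,1]$; given the types, rewards are independent across arms and pulls and the mean of $X_{i,j}$ is the mean of the type of arm $i$ (the rewards of an arm need not be identically distributed). The regret after $n$ plays is $R_n=\sum_{t=1}^n(\mu_1-Y_t)$, where $Y_t$ is the reward obtained in round $t$. **Algorithm ALG2.** The algorithm proceeds in epochs. In the first two rounds of an epoch it plays two new arms queried from the reservoir, called $1$ and $2$ within the epoch; it sets $m=1$ and draws an independent standard Gaussian sample $\mathcal Z$. In each later round, say the $t$-th of the epoch ($t\ge 3$), it first tests whether $$\Bigl|\mathcal Z+\sum_{j=1}^m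 (X_{1,j}-X_{2,j})\Bigr|<4\sqrt{m\log m}.$$ If so, both arms are discarded for good and a new epoch begins with this round. Otherwise it plays an arm $i\in\{1,2\}$ maximizing $$\frac1{N_i(t-1)}\sum_{j=1}^{N_i(t-1)}X_{i,j}+\sqrt{\frac{2\log(t-1)}{N_i(t-1)}},$$ where $N_i(s)$ is the number of pulls of arm $i$ in the first $s$ rounds of the epoch, and increases $m$ by $1$ if $m<\min(N_1(t),N_2(t))$. Ties are broken by an arbitrary measurable rule that may use the observed actions and rewards of the past and independent randomization. **Constant.** Let $\bar\Phi(v)=\frac1{\sqrt{2\pi}}\int_v^\infty e^{-u^2/2}\,du$, $f(x)=x+4\sqrt{x\log x}$, $T_0=\bigl\lceil \frac{64}{\Delta^2}\log^2\frac{64}{\Delta^2}\bigr\rceil$ and $\beta_\Delta=\frac12\bar\Phi(f(T_0))$. **Theorem.** Under ALG2, $R_n$ is integrable for every $n$, and $$\limsup_{n\to\infty}\frac{\mathbb E R_n}{\log n}\le\frac{16c}{\Delta}\sum_{k=0}^\infty\exp\Bigl(-\beta_\Delta\sum_{j=0}^{k-1}g(2j)\Bigr),$$ where the right-hand side may be $+\infty$.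 If $g$ is constant (equal to $c$), the right-hand side is at most $32/(\Delta\beta_\Delta)$, which does not depend on $c$. -/

import Mathlib

open MeasureTheory ProbabilityTheory Filter

namespace Bandit

/-- The two arm-types of the reservoir. -/
inductive ArmType
  | optimal
  | inferior
deriving DecidableEq

/-- Names of the elementary sources of randomness. Arms are labelled `0, 1, 2, …` in the order in
which they are queried from the reservoir, epochs and rounds are numbered from `0`.
* `mark a`: the uniform draw by which the reservoir decides the type of the arm `a`;
* `reward k a j`: the reward of the `(j + 1)`-st pull of the arm `a`, if that arm has type `k`;
* `noise e`: the Gaussian sample of the epoch `e`;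
* `coin t`: extra randomness available for breaking a tie in round `t`. -/
inductive Source
  | mark (a : ℕ)
  | reward (k : ArmType) (a j : ℕ)
  | noise (e : ℕ)
  | coin (t : ℕ)
deriving DecidableEq

/-- The standing assumptions on the sources of randomness: they are independent; the marks are
uniform on `[0,1]`, the noises are standard Gaussian, and rewards take values in `[0,1]` with a mean
that depends only on the type of the arm. Reward laws may vary with the arm and with the pull;
nothing is assumed about the law of the coins. -/
structure IsPrimitives {Ω : Type*} [MeasurableSpace Ω] (P : Measure Ω) (mean : ArmType → ℝ)
    (W : Source → Ω → ℝ) : Prop where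
  measurable : ∀ s, Measurable (W s)
  indep : iIndepFun W P
  mark_law : ∀ a, P.map (W (.mark a)) = volume.restrict (Set.Icc (0 : ℝ) 1)
  noise_law : ∀ e, P.map (W (.noise e)) = gaussianReal 0 1
  reward_mem : ∀ k a j, ∀ᵐ ω ∂P, W (.reward k a j) ω ∈ Set.Icc (0 : ℝ) 1
  reward_mean : ∀ k a j, ∫ ω, W (.reward k a j) ω ∂P = mean k

/-- The endogenous reservoir with parameter `c`: the next queried arm is optimal with probability
`g J` when `J` queries have been made before; `g` is non-increasing with values in `(0, c]` and
`g 0 = c`, where `0 < c < 1`. -/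
structure IsEndogenousReservoir (c : ℝ) (g : ℕ → ℝ) : Prop where
  pos : 0 < c
  lt_one : c < 1
  zero : g 0 = c
  antitone : Antitone g
  mem : ∀ u, g u ∈ Set.Ioc 0 c

/-- The situation after some number of rounds. -/
structure State where
  /-- number of reservoir queries made so far; also the label of the next new arm -/
  queries : ℕ
  /-- types of the arms queried so far (a meaningless default for all other labels) -/
  kind : ℕ → ArmType
  /-- number of pulls of each arm -/
  pulls : ℕ → ℕ
  /-- arm played and reward observed in each past round, and `(0, 0)` for future rounds -/
  obs : ℕ → ℕ × ℝ
  /-- number of the current epoch -/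
  epoch : ℕ
  /-- number of rounds played so far in the current epoch -/
  clock : ℕ
  /-- first arm of the current consideration set -/
  fst : ℕ
  /-- second arm of the current consideration set -/
  snd : ℕ
  /-- minimum per-arm sample count in the current epoch -/
  m : ℕ

/-- The situation before the first round. -/
def State.init : State where
  queries := 0
  kind := fun _ => .inferior
  pulls := fun _ => 0
  obs := fun _ => (0, 0)
  epoch := 0
  clock := 0
  fst := 0
  snd := 0
  m := 1

/-- A rule for breaking ties: given the round, the observations of the past rounds and the coin of
the round, say whether the first arm of the consideration set is preferred. -/
abbrev TieRule := ℕ → (ℕ → ℕ × ℝ) → ℝ → Bool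

noncomputable section

/-- `X w s a j` is the reward of the `(j + 1)`-st pull of the arm `a`, which has already been queried
in the situation `s`. -/
def X (w : Source → ℝ) (s : State) (a j : ℕ) : ℝ := w (.reward (s.kind a) a j)

/-- Pull the already queried arm `a` in round `t`. -/
def pull (w : Source → ℝ) (t a : ℕ) (s : State) : State :=
  { s with
    pulls := Function.update s.pulls a (s.pulls a + 1)
    obs := Function.update s.obs t (a, X w s a (s.pulls a))
    clock := s.clock + 1 }

open Classical in
/-- Query a new arm (with label `s.queries`) from the reservoir. Its type is optimal with probability
`g s.queries`, where `s.queries` is the number of queries made before. -/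
def query (g : ℕ → ℝ) (w : Source → ℝ) (s : State) : State :=
  { s with
    queries := s.queries + 1
    kind := Function.update s.kind s.queries
      (if w (.mark s.queries) < g s.queries then .optimal else .inferior) }

/-- The test by which the current consideration set is discarded:
`|Z + ∑_{j ≤ m} (X_{1,j} - X_{2,j})| < 4 √(m log m)`. -/
def Discards (w : Source → ℝ) (s : State) : Prop :=
  |w (.noise s.epoch) + ∑ j ∈ Finset.range s.m, (X w s s.fst j - X w s s.snd j)|
    < 4 * Real.sqrt (s.m * Real.log s.m)

/-- The upper confidence index of an arm of the consideration set: its empirical mean plus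
`√(2 log (t - 1) / N)`, where `t - 1 = s.clock` rounds of the epoch have been played, `N` of them
with this arm. -/
def ucbIndex (w : Source → ℝ) (s : State) (a : ℕ) : ℝ :=
  (∑ j ∈ Finset.range (s.pulls a), X w s a j) / s.pulls a
    + Real.sqrt (2 * Real.log s.clock / s.pulls a)

open Classical in
/-- The arm of the consideration set with the larger index. -/
def ucbArm (tie : TieRule) (w : Source → ℝ) (t : ℕ) (s : State) : ℕ :=
  if ucbIndex w s s.snd < ucbIndex w s s.fst then s.fst
  else if ucbIndex w s s.fst < ucbIndex w s s.snd then s.snd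
  else if tie t s.obs (w (.coin t)) then s.fst else s.snd

/-- Increase the minimum per-arm sample count by one, if both arms allow it. -/
def refresh (s : State) : State :=
  { s with m := if s.m < min (s.pulls s.fst) (s.pulls s.snd) then s.m + 1 else s.m }

/-- The start of an epoch: query and play the first new arm. -/
def playFirst (g : ℕ → ℝ) (w : Source → ℝ) (t : ℕ) (s : State) : State :=
  pull w t s.queries { query g w s with fst := s.queries, clock := 0 }

/-- The second round of an epoch: query and play the second new arm, and set `m` to `1`. -/
def playSecond (g : ℕ → ℝ) (w : Source → ℝ) (t : ℕ) (s : State) : State :=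
  pull w t s.queries { query g w s with snd := s.queries, m := 1 }

open Classical in
/-- Round `t` of the nested UCB algorithm ALG2. From the third round of an epoch on, the consideration
set is tested first; if it is discarded, the round is the first one of a new epoch. -/
def step (g : ℕ → ℝ) (tie : TieRule) (w : Source → ℝ) (t : ℕ) (s : State) : State :=
  if s.clock = 0 then playFirst g w t s
  else if s.clock = 1 then playSecond g w t s
  else if Discards w s then playFirst g w t { s with epoch := s.epoch + 1 }
  else refresh (pull w t (ucbArm tie w t s) s)

/-- The situation under ALG2 after `n` rounds, as a function of the realized randomness `w`. -/
def run (g : ℕ → ℝ) (tie : TieRule) (w : Source → ℝ) : ℕ → State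
  | 0 => State.init
  | t + 1 => step g tie w t (run g tie w t)

/-- The cumulative regret of ALG2 after `n` plays: the sum over the first `n` rounds of `μ₁` minus the
reward obtained. -/
def regret (mean : ArmType → ℝ) (g : ℕ → ℝ) (tie : TieRule) (w : Source → ℝ) (n : ℕ) : ℝ :=
  ∑ t ∈ Finset.range n, (mean .optimal - ((run g tie w n).obs t).2)

/-- The right tail of the standard Gaussian distribution. -/
def gaussianTail (v : ℝ) : ℝ :=
  1 / Real.sqrt (2 * Real.pi) * ∫ u in Set.Ioi v, Real.exp (-u ^ 2 / 2)

/-- `T₀ = ⌈(64/Δ²) log² (64/Δ²)⌉`. -/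
def T₀ (Δ : ℝ) : ℕ := ⌈64 / Δ ^ 2 * Real.log (64 / Δ ^ 2) ^ 2⌉₊

/-- `f x = x + 4 √(x log x)`. -/
def f (x : ℝ) : ℝ := x + 4 * Real.sqrt (x * Real.log x)

/-- `β_Δ`, half the right tail of the standard Gaussian distribution at `f T₀`. -/
def β (Δ : ℝ) : ℝ := gaussianTail (f (T₀ Δ)) / 2

/-- The bound `(16 c / Δ) ∑_{k ≥ 0} exp (-β_Δ ∑_{j < k} g (2 j))`, possibly infinite. -/
def bound (c Δ : ℝ) (g : ℕ → ℝ) : ENNReal :=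
  ENNReal.ofReal (16 * c / Δ) *
    ∑' k : ℕ, ENNReal.ofReal (Real.exp (-β Δ * ∑ j ∈ Finset.range k, g (2 * j)))

end

end Bandit

open MeasureTheory ProbabilityTheory Filter

namespace Bandit

noncomputable section

/-! ### Events determined by a single epoch -/

/-! The regret is first reduced to a count. Whether a given pull of a given arm happens in round `t`
does not depend on the reward which that pull will yield, so the expected reward of a round is the
expected mean of the arm played, and the expected regret is `Δ` times the expected number of plays
of inferior arms (`integral_regret`).

All randomness is labelled in advance: epoch `e` can only involve the arms `2 * e` and `2 * e + 1`
and the noise `e`. Hence events attached to different epochs are independent, although the length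
and the starting time of an epoch are random. An invariant of the algorithm (`inv_run`) gives a
bound for every realization: the inferior pulls of epoch `e` number at most `epochBound`, a function
of the sources of that epoch alone (`sum_played_inferior_le`). If the types differ, the index rule
limits the inferior arm to `L = 8 log n / Δ²` pulls, plus one for each time of deviation. If both
arms are inferior, the index rule keeps the two counts proportional, so a long epoch forces `m` to
be large, and each sample count below `m` must have passed the test. Deviations and passed tests
have probabilities of order `1 / t ^ 2`, so the expected bound is at most `mixProb * L + epochConst`
(`integral_epochBound_le`).

Two arms of different types survive the test forever with probability at least `β Δ`: independently,
a large noise covers the sample counts up to `T₀`, and with probability at least one half the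
optimal arm stays ahead by the threshold afterwards (`prob_survive_ge`). Thus an epoch is abandoned
with probability at most `1 - β * mixProb` (`prob_abandoned_le`). Multiplying over epochs and
telescoping gives `∑ reachProb * mixProb ≤ 1 / β` (`sum_reachProb_mul_mixProb_le`). The regret is
therefore at most `8 / (Δ β) * log n` plus a constant, provided that `∑ reachProb` is finite;
convergence of the series in `bound` ensures this (`summable_reachProb`).

Finally `g ≤ c` makes that series at least a geometric one, so that `bound` is at least `16 / (Δ β)`
(`le_bound`), which leaves a factor of two to absorb the constant. If the series diverges there is
nothing to prove. -/

open Classical in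
/-- The type that the reservoir assigns to the arm `a`. -/
def drawnKind (g : ℕ → ℝ) (w : Source → ℝ) (a : ℕ) : ArmType :=
  if w (.mark a) < g a then .optimal else .inferior

/-- The test of epoch `e` at sample count `m`, if its arms have the types `k₁` and `k₂`. -/
def Rejects (w : Source → ℝ) (k₁ k₂ : ArmType) (e m : ℕ) : Prop :=
  |w (.noise e) + ∑ j ∈ Finset.range m, (w (.reward k₁ (2 * e) j) - w (.reward k₂ (2 * e + 1) j))|
    < 4 * Real.sqrt (m * Real.log m)

/-- Some empirical mean of an arm of epoch `e`, over at most `t` pulls, is off by at least `7/8` of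
the confidence radius of round `t`. -/
def Deviates (mean : ArmType → ℝ) (w : Source → ℝ) (e t : ℕ) : Prop :=
  ∃ k : ArmType, ∃ i < 2, ∃ s : ℕ, 1 ≤ s ∧ s ≤ t ∧
    7 / 8 * Real.sqrt (2 * s * Real.log t) ≤
      |∑ j ∈ Finset.range s, w (.reward k (2 * e + i) j) - s * mean k|

/-- The test of epoch `e` fails at some sample count. -/
def Abandoned (g : ℕ → ℝ) (w : Source → ℝ) (e : ℕ) : Prop :=
  ∃ m, Rejects w (drawnKind g w (2 * e)) (drawnKind g w (2 * e + 1)) e m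

open Classical in
/-- The number of `t < n` for which epoch `e` has a deviation at time `t`. -/
def devCount (mean : ArmType → ℝ) (w : Source → ℝ) (e n : ℕ) : ℕ :=
  ((Finset.range n).filter fun t => Deviates mean w e t).card

open Classical in
/-- The number of sample counts `m < n` at which two inferior arms would survive the test. -/
def keepCount (w : Source → ℝ) (e n : ℕ) : ℕ :=
  ((Finset.range n).filter fun m => ¬ Rejects w .inferior .inferior e m).card

open Classical in
/-- The bound for the number of pulls of inferior arms in epoch `e` during the first `n` rounds. -/
def epochBound (mean : ArmType → ℝ) (g : ℕ → ℝ) (L : ℝ) (n : ℕ) (w : Source → ℝ) (e : ℕ) : ℝ :=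
  (if drawnKind g w (2 * e) ≠ drawnKind g w (2 * e + 1) then L else 0)
    + 226 * (1 + keepCount w e n) + 1 + devCount mean w e n

open Classical in
/-- The number of pulls of inferior arms in epoch `e`. -/
def infPulls (g : ℕ → ℝ) (w : Source → ℝ) (s : State) (e : ℕ) : ℕ :=
  (if drawnKind g w (2 * e) = .inferior then s.pulls (2 * e) else 0)
    + if drawnKind g w (2 * e + 1) = .inferior then s.pulls (2 * e + 1) else 0

open Classical in
/-- The arm played in round `t` in the situation `s`. -/
def chosenArm (tie : TieRule) (w : Source → ℝ) (t : ℕ) (s : State) : ℕ :=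
  if s.clock < 2 ∨ Discards w s then s.queries else ucbArm tie w t s

/-- The arm played in round `t`. -/
def played (g : ℕ → ℝ) (tie : TieRule) (w : Source → ℝ) (t : ℕ) : ℕ :=
  chosenArm tie w t (run g tie w t)

/-! ### One round of the algorithm, and counting plays by arms -/

section Step

variable (g : ℕ → ℝ) (tie : TieRule) (w : Source → ℝ) (t : ℕ) (s : State)

lemma step_pulls : (step g tie w t s).pulls =
    Function.update s.pulls (chosenArm tie w t s) (s.pulls (chosenArm tie w t s) + 1) := by
  classical
  unfold step chosenArm
  split_ifs with h₀ h₁ h₂ h₃ h₃ h₃ h₃ <;>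
    first | rfl | (exfalso; tauto) | (rcases h₃ with h₃ | h₃ <;> [omega; contradiction]) | omega

lemma step_obs : (step g tie w t s).obs =
    Function.update s.obs t (chosenArm tie w t s,
      w (.reward ((step g tie w t s).kind (chosenArm tie w t s)) (chosenArm tie w t s)
        (s.pulls (chosenArm tie w t s)))) := by
  classical
  unfold step chosenArm
  split_ifs with h₀ h₁ h₂ h₃ h₃ h₃ h₃ <;>
    first | rfl | (exfalso; tauto) | (rcases h₃ with h₃ | h₃ <;> [omega; contradiction]) | omega

lemma ucbArm_cases : (ucbArm tie w t s = s.fst ∧ ucbIndex w s s.snd ≤ ucbIndex w s s.fst) ∨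
    (ucbArm tie w t s = s.snd ∧ ucbIndex w s s.fst ≤ ucbIndex w s s.snd) := by
  classical
  unfold ucbArm
  split_ifs with h1 h2 h3
  · exact .inl ⟨rfl, h1.le⟩
  · exact .inr ⟨rfl, h2.le⟩
  · exact .inl ⟨rfl, not_lt.1 h2⟩
  · exact .inr ⟨rfl, not_lt.1 h1⟩

end Step

/-- Each round raises exactly one entry of `pulls` by one, so a sum over rounds can be regrouped by
arms. -/
lemma sum_played (g : ℕ → ℝ) (tie : TieRule) (w : Source → ℝ) (F : ℕ → ℝ) (M n : ℕ)
    (h : ∀ t < n, played g tie w t < M) :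
    ∑ t ∈ Finset.range n, F (played g tie w t) =
      ∑ a ∈ Finset.range M, (run g tie w n).pulls a * F a := by
  induction n with
  | zero => simp [run, State.init]
  | succ n ih =>
    rw [Finset.sum_range_succ, ih fun t ht => h t (by omega)]
    have hM := h n (by omega)
    rw [run, step_pulls]
    change _ + F (played g tie w n) =
      ∑ a ∈ Finset.range M, ((Function.update (run g tie w n).pulls (played g tie w n)
        ((run g tie w n).pulls (played g tie w n) + 1) a : ℕ) : ℝ) * F a
    have : ∀ a ∈ Finset.range M, ((Function.update (run g tie w n).pulls (played g tie w n)
        ((run g tie w n).pulls (played g tie w n) + 1) a : ℕ) : ℝ) * F a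
        = (run g tie w n).pulls a * F a + if a = played g tie w n then F a else 0 := by
      intro a _
      by_cases ha : a = played g tie w n
      · subst ha; simp; ring
      · simp [ha]
    rw [Finset.sum_congr rfl this, Finset.sum_add_distrib]
    simp [hM]

/-! ### Consequences of the index rule -/

/-- An error of strictly less than the full confidence radius leaves a positive multiple, `1 - 7/8`,
of the radius of the arm not chosen. This remainder is what makes two arms of equal mean stay
balanced. -/
lemma index_gap {μa μb Sa Sb L Na Nb : ℝ} (hNa : 0 < Na) (hNb : 0 < Nb)
    (ha : |Sa - Na * μa| < 7 / 8 * √(2 * Na * L)) (hb : |Sb - Nb * μb| < 7 / 8 * √(2 * Nb * L))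
    (h : Sb / Nb + √(2 * L / Nb) ≤ Sa / Na + √(2 * L / Na)) :
    μb + 1 / 8 * √(2 * L / Nb) < μa + 15 / 8 * √(2 * L / Na) := by
  have key : ∀ N : ℝ, 0 < N → √(2 * N * L) = N * √(2 * L / N) := by
    intro N hN
    rw [show 2 * N * L = N ^ 2 * (2 * L / N) by field_simp, Real.sqrt_mul (sq_nonneg _),
      Real.sqrt_sq hN.le]
  rw [key _ hNa] at ha
  rw [key _ hNb] at hb
  have h1 : Sa / Na < μa + 7 / 8 * √(2 * L / Na) := by
    rw [div_lt_iff₀ hNa]; nlinarith [(abs_lt.1 ha).2]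
  have h2 : μb - 7 / 8 * √(2 * L / Nb) < Sb / Nb := by
    rw [lt_div_iff₀ hNb]; nlinarith [(abs_lt.1 hb).1]
  linarith

/-- With equal means the radii differ by a factor of at most `(15/8) / (1/8) = 15`, and the counts
by its square. -/
lemma le_of_index_gap_of_eq {μ L Na Nb : ℝ} (hL : 0 < L) (hNa : 0 < Na) (hNb : 0 < Nb)
    (h : μ + 1 / 8 * √(2 * L / Nb) < μ + 15 / 8 * √(2 * L / Na)) : Na ≤ 225 * Nb := by
  have h1 : √(2 * L / Nb) ≤ 15 * √(2 * L / Na) := by linarith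
  have h2 := pow_le_pow_left₀ (Real.sqrt_nonneg _) h1 2
  rw [mul_pow, Real.sq_sqrt (by positivity), Real.sq_sqrt (by positivity), ← mul_div_assoc,
    div_le_div_iff₀ hNb hNa] at h2
  have : 2 * L * Na ≤ 2 * L * (225 * Nb) := by linarith
  exact le_of_mul_le_mul_left this (by positivity)

/-- The leftover radius of the better arm is dropped and `15/8` is rounded up to `2`; squaring gives
the factor `4 * 2 = 8`. -/
lemma le_of_index_gap_of_lt {μa μb L Na Nb : ℝ} (hL : 0 < L) (hNa : 0 < Na)
    (hμ : μa < μb) (h : μb + 1 / 8 * √(2 * L / Nb) < μa + 15 / 8 * √(2 * L / Na)) :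
    Na ≤ 8 * L / (μb - μa) ^ 2 := by
  have h0 := Real.sqrt_nonneg (2 * L / Nb)
  have h1 : μb - μa ≤ 2 * √(2 * L / Na) := by linarith [Real.sqrt_nonneg (2 * L / Na)]
  have h2 := pow_le_pow_left₀ (sub_pos.2 hμ).le h1 2
  rw [mul_pow, Real.sq_sqrt (by positivity), ← mul_div_assoc, le_div_iff₀ hNa] at h2
  rw [le_div_iff₀ (by have := sub_pos.2 hμ; positivity)]
  linarith

/-! ### Invariants of the algorithm -/

/-- What holds in every situation, whatever the position within the epoch. -/
structure BaseInv (mean : ArmType → ℝ) (g : ℕ → ℝ) (L : ℝ) (N : ℕ) (w : Source → ℝ) (n : ℕ)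
    (s : State) : Prop where
  kind_eq : ∀ a < s.queries, s.kind a = drawnKind g w a
  pulls_zero : ∀ a, s.queries ≤ a → s.pulls a = 0
  epoch_le : s.epoch ≤ n
  clock_le : s.clock ≤ n
  abandoned : ∀ e < s.epoch, Abandoned g w e
  past : ∀ e < s.epoch, (infPulls g w s e : ℝ) ≤ epochBound mean g L N w e

/-- What holds from the second round of an epoch on. -/
structure EpochInv (mean : ArmType → ℝ) (g : ℕ → ℝ) (L : ℝ) (w : Source → ℝ) (s : State) :
    Prop where
  queries_eq : s.queries = 2 * s.epoch + 2
  fst_eq : s.fst = 2 * s.epoch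
  snd_eq : s.snd = 2 * s.epoch + 1
  clock_eq : s.pulls (2 * s.epoch) + s.pulls (2 * s.epoch + 1) = s.clock
  m_eq : s.m = min (s.pulls (2 * s.epoch)) (s.pulls (2 * s.epoch + 1))
  m_pos : 1 ≤ s.m
  kept : ∀ i < s.m,
    ¬ Rejects w (drawnKind g w (2 * s.epoch)) (drawnKind g w (2 * s.epoch + 1)) s.epoch i
  balanced : drawnKind g w (2 * s.epoch) = .inferior →
    drawnKind g w (2 * s.epoch + 1) = .inferior →
    s.pulls (2 * s.epoch) ≤
      225 * s.pulls (2 * s.epoch + 1) + 1 + devCount mean w s.epoch s.clock ∧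
    s.pulls (2 * s.epoch + 1) ≤
      225 * s.pulls (2 * s.epoch) + 1 + devCount mean w s.epoch s.clock
  fst_le : drawnKind g w (2 * s.epoch) = .inferior →
    drawnKind g w (2 * s.epoch + 1) = .optimal →
    (s.pulls (2 * s.epoch) : ℝ) ≤ L + 1 + devCount mean w s.epoch s.clock
  snd_le : drawnKind g w (2 * s.epoch) = .optimal →
    drawnKind g w (2 * s.epoch + 1) = .inferior →
    (s.pulls (2 * s.epoch + 1) : ℝ) ≤ L + 1 + devCount mean w s.epoch s.clock

/-- The invariant of the algorithm. -/
structure Inv (mean : ArmType → ℝ) (g : ℕ → ℝ) (L : ℝ) (N : ℕ) (w : Source → ℝ) (n : ℕ)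
    (s : State) : Prop extends BaseInv mean g L N w n s where
  zero : s.clock = 0 → s.queries = 2 * s.epoch
  one : s.clock = 1 → s.queries = 2 * s.epoch + 1 ∧ s.fst = 2 * s.epoch ∧
    s.pulls (2 * s.epoch) = 1
  two : 2 ≤ s.clock → EpochInv mean g L w s

lemma devCount_mono (mean : ArmType → ℝ) (w : Source → ℝ) (e : ℕ) : Monotone (devCount mean w e) := by
  classical
  exact fun _ _ h => Finset.card_le_card (Finset.filter_subset_filter _ (Finset.range_mono h))

lemma devCount_succ_of_deviates {mean : ArmType → ℝ} {w : Source → ℝ} {e t : ℕ}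
    (h : Deviates mean w e t) : devCount mean w e (t + 1) = devCount mean w e t + 1 := by
  classical
  unfold devCount
  rw [Finset.range_add_one, Finset.filter_insert, if_pos h, Finset.card_insert_of_notMem (by simp)]

/-- The case distinction is by the types of the two arms. For two inferior arms, balance bounds the
total by `226` times the smaller count plus corrections; the smaller count is `m`, and every sample
count below `m` has passed the test, so `keepCount` controls it. -/
lemma le_epochBound_of_epochInv {mean : ArmType → ℝ} {g : ℕ → ℝ} {L : ℝ} {N n : ℕ}
    {w : Source → ℝ} {s : State} (hn : n ≤ N) (hb : BaseInv mean g L N w n s)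
    (h : EpochInv mean g L w s) :
    (infPulls g w s s.epoch : ℝ) ≤ epochBound mean g L N w s.epoch := by
  classical
  have hdev : devCount mean w s.epoch s.clock ≤ devCount mean w s.epoch N :=
    devCount_mono _ _ _ (hb.clock_le.trans hn)
  have hdev' : (devCount mean w s.epoch s.clock : ℝ) ≤ devCount mean w s.epoch N := by
    exact_mod_cast hdev
  unfold infPulls epochBound
  rcases h1 : drawnKind g w (2 * s.epoch) with _ | _ <;>
    rcases h2 : drawnKind g w (2 * s.epoch + 1) with _ | _
  · simp; positivity
  · have := h.snd_le h1 h2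
    simp only [reduceCtorEq, if_false, if_true, ne_eq, not_false_eq_true]
    push_cast
    have : (0 : ℝ) ≤ keepCount w s.epoch N := by positivity
    linarith
  · have := h.fst_le h1 h2
    simp only [reduceCtorEq, if_false, if_true, ne_eq, not_false_eq_true]
    push_cast
    have : (0 : ℝ) ≤ keepCount w s.epoch N := by positivity
    linarith
  · have hbal := h.balanced h1 h2
    have hm : s.m ≤ 1 + keepCount w s.epoch N := by
      have hsub : Finset.range s.m ⊆
          (Finset.range N).filter fun m => ¬ Rejects w .inferior .inferior s.epoch m := by
        intro i hi
        have hi' := Finset.mem_range.1 hi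
        have hk := h.kept i hi'
        rw [h1, h2] at hk
        have := h.clock_eq
        have := h.m_eq
        have := hb.clock_le
        simp only [Finset.mem_filter, Finset.mem_range]
        exact ⟨by omega, hk⟩
      have := Finset.card_le_card hsub
      rw [Finset.card_range] at this
      unfold keepCount
      convert Nat.le_add_left_of_le this
    have hm' := h.m_eq
    have hc := h.clock_eq
    have : s.pulls (2 * s.epoch) + s.pulls (2 * s.epoch + 1) ≤
        226 * (1 + keepCount w s.epoch N) + 1 + devCount mean w s.epoch N := by omega
    simp only [if_true, ne_eq, not_true_eq_false, if_false, zero_add]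
    exact_mod_cast this

lemma infPulls_update_of_le {g : ℕ → ℝ} {w : Source → ℝ} {s s' : State} {e b v : ℕ}
    (hs : s'.pulls = Function.update s.pulls b v) (hb : 2 * e + 2 ≤ b) :
    infPulls g w s' e = infPulls g w s e := by
  unfold infPulls
  rw [hs, Function.update_of_ne (by omega), Function.update_of_ne (by omega)]

/-- The hypothesis carries `n + 1` already, because a discarding round raises the epoch number
before it plays. -/
lemma inv_playFirst {mean : ArmType → ℝ} {g : ℕ → ℝ} {L : ℝ} {N n : ℕ} {w : Source → ℝ}
    {s : State} (h : BaseInv mean g L N w (n + 1) s) (hq : s.queries = 2 * s.epoch) :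
    Inv mean g L N w (n + 1) (playFirst g w n s) := by
  classical
  refine { kind_eq := ?_, pulls_zero := ?_, epoch_le := h.epoch_le, clock_le := ?_,
           abandoned := h.abandoned, past := ?_, zero := ?_, one := ?_, two := ?_ }
  · intro a ha
    have ha' : a < s.queries + 1 := ha
    change Function.update s.kind s.queries _ a = _
    rcases eq_or_ne a s.queries with rfl | hne
    · simp [drawnKind]
    · rw [Function.update_of_ne hne]; exact h.kind_eq a (by omega)
  · intro a ha
    have ha' : s.queries + 1 ≤ a := ha
    change Function.update s.pulls s.queries _ a = 0
    rw [Function.update_of_ne (by omega)]; exact h.pulls_zero a (by omega)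
  · change 0 + 1 ≤ n + 1; omega
  · intro e he
    have he' : e < s.epoch := he
    rw [infPulls_update_of_le (s := s) (b := s.queries) (v := s.pulls s.queries + 1) rfl (by omega)]
    exact h.past e he
  · intro hc; exact absurd (show 0 + 1 = 0 from hc) (by omega)
  · intro _
    refine ⟨?_, hq, ?_⟩
    · change s.queries + 1 = 2 * s.epoch + 1; omega
    · change Function.update s.pulls s.queries (s.pulls s.queries + 1) (2 * s.epoch) = 1
      rw [hq]; simp [h.pulls_zero (2 * s.epoch) hq.le]
  · intro hc; exact absurd (show 2 ≤ 0 + 1 from hc) (by omega)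

lemma inv_playSecond {mean : ArmType → ℝ} {g : ℕ → ℝ} {L : ℝ} {N n : ℕ} {w : Source → ℝ}
    {s : State} (hL : 0 ≤ L) (h : Inv mean g L N w n s) (hc : s.clock = 1) :
    Inv mean g L N w (n + 1) (playSecond g w n s) := by
  classical
  obtain ⟨hq, hf, hp⟩ := h.one hc
  have hp1 : (playSecond g w n s).pulls (2 * s.epoch) = 1 := by
    change Function.update s.pulls s.queries (s.pulls s.queries + 1) (2 * s.epoch) = 1
    rw [Function.update_of_ne (by omega), hp]
  have hp2 : (playSecond g w n s).pulls (2 * s.epoch + 1) = 1 := by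
    change Function.update s.pulls s.queries (s.pulls s.queries + 1) (2 * s.epoch + 1) = 1
    rw [← hq]; simp [h.pulls_zero s.queries le_rfl]
  have hcl : (playSecond g w n s).clock = 2 := by
    change s.clock + 1 = 2; omega
  refine { kind_eq := ?_, pulls_zero := ?_, epoch_le := h.epoch_le.trans (by omega), clock_le := ?_,
           abandoned := h.abandoned, past := ?_, zero := ?_, one := ?_, two := ?_ }
  · intro a ha
    have ha' : a < s.queries + 1 := ha
    change Function.update s.kind s.queries _ a = _
    rcases eq_or_ne a s.queries with rfl | hne
    · simp [drawnKind]
    · rw [Function.update_of_ne hne]; exact h.kind_eq a (by omega)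
  · intro a ha
    have ha' : s.queries + 1 ≤ a := ha
    change Function.update s.pulls s.queries _ a = 0
    rw [Function.update_of_ne (by omega)]; exact h.pulls_zero a (by omega)
  · have := h.clock_le; omega
  · intro e he
    have he' : e < s.epoch := he
    rw [infPulls_update_of_le (s := s) (b := s.queries) (v := s.pulls s.queries + 1) rfl (by omega)]
    exact h.past e he
  · omega
  · omega
  · intro _
    have hbd : (1 : ℝ) ≤ L + 1 + devCount mean w s.epoch (playSecond g w n s).clock := by
      have : (0 : ℝ) ≤ devCount mean w s.epoch (playSecond g w n s).clock := by positivity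
      linarith
    refine { queries_eq := ?_, fst_eq := hf, snd_eq := hq, clock_eq := ?_, m_eq := ?_,
             m_pos := le_rfl, kept := ?_, balanced := ?_, fst_le := ?_, snd_le := ?_ }
    · change s.queries + 1 = 2 * s.epoch + 2; omega
    · change (playSecond g w n s).pulls (2 * s.epoch) +
        (playSecond g w n s).pulls (2 * s.epoch + 1) = _
      omega
    · change 1 = min ((playSecond g w n s).pulls (2 * s.epoch))
        ((playSecond g w n s).pulls (2 * s.epoch + 1))
      simp [hp1, hp2]
    · intro i hi
      have : i = 0 := by have : i < 1 := hi; omega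
      subst this
      -- At sample count `0` the threshold is `0`, so the test cannot reject.
      simp [Rejects]
    · intro _ _
      change (playSecond g w n s).pulls (2 * s.epoch) ≤
        225 * (playSecond g w n s).pulls (2 * s.epoch + 1) + 1 + _ ∧
        (playSecond g w n s).pulls (2 * s.epoch + 1) ≤
        225 * (playSecond g w n s).pulls (2 * s.epoch) + 1 + _
      omega
    · intro _ _
      change ((playSecond g w n s).pulls (2 * s.epoch) : ℝ) ≤ _
      rw [hp1]; exact_mod_cast hbd
    · intro _ _
      change ((playSecond g w n s).pulls (2 * s.epoch + 1) : ℝ) ≤ _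
      rw [hp2]; exact_mod_cast hbd

/-- Here `i` is the chosen arm and `j` the other one. Outside the deviation event both empirical
means are accurate enough for the deterministic gap inequalities. -/
lemma chosen_le_of_not_deviates {mean : ArmType → ℝ} {w : Source → ℝ} {e t i j Ni Nj : ℕ}
    {ki kj : ArmType} (hΔ : mean .inferior < mean .optimal) (ht : 2 ≤ t)
    (hdev : ¬ Deviates mean w e t) (hi : i < 2) (hj : j < 2)
    (hNi : 1 ≤ Ni) (hNj : 1 ≤ Nj) (hNit : Ni ≤ t) (hNjt : Nj ≤ t)
    (h : (∑ l ∈ Finset.range Nj, w (.reward kj (2 * e + j) l)) / Nj + √(2 * Real.log t / Nj) ≤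
      (∑ l ∈ Finset.range Ni, w (.reward ki (2 * e + i) l)) / Ni + √(2 * Real.log t / Ni)) :
    (ki = kj → Ni ≤ 225 * Nj) ∧
    (ki = .inferior → kj = .optimal →
      (Ni : ℝ) ≤ 8 * Real.log t / (mean .optimal - mean .inferior) ^ 2) := by
  have hlog : 0 < Real.log t := Real.log_pos (by exact_mod_cast ht)
  have hNi' : (0 : ℝ) < Ni := by exact_mod_cast hNi
  have hNj' : (0 : ℝ) < Nj := by exact_mod_cast hNj
  have dev : ∀ k : ArmType, ∀ l < 2, ∀ s : ℕ, 1 ≤ s → s ≤ t →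
      |∑ r ∈ Finset.range s, w (.reward k (2 * e + l) r) - s * mean k| <
        7 / 8 * √(2 * s * Real.log t) := by
    intro k l hl s h1 h2
    by_contra hcon
    exact hdev ⟨k, l, hl, s, h1, h2, not_lt.1 hcon⟩
  have gap := index_gap hNi' hNj' (dev ki i hi Ni hNi hNit) (dev kj j hj Nj hNj hNjt) h
  constructor
  · rintro rfl
    exact_mod_cast le_of_index_gap_of_eq hlog hNi' hNj' gap
  · rintro rfl rfl
    exact le_of_index_gap_of_lt hlog hNi' hΔ gap

/-- Only the count of the chosen arm grows. Either there is a deviation at the current clock, and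
the increase of `devCount` pays for the pull, or the count before the pull obeyed the bound of the
index rule, and the summand `1` in the invariant pays. -/
lemma epochInv_ucb {mean : ArmType → ℝ} {g : ℕ → ℝ} {tie : TieRule} {L : ℝ} {N n : ℕ}
    {w : Source → ℝ} {s : State} (hΔ : mean .inferior < mean .optimal)
    (hL : ∀ t : ℕ, 2 ≤ t → t ≤ N →
      8 * Real.log t / (mean .optimal - mean .inferior) ^ 2 ≤ L)
    (hn : n ≤ N) (h : Inv mean g L N w n s) (hc : 2 ≤ s.clock) (hd : ¬ Discards w s) :
    EpochInv mean g L w (refresh (pull w n (ucbArm tie w n s) s)) := by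
  classical
  have he := h.two hc
  set e := s.epoch with he_def
  set k₁ := drawnKind g w (2 * e) with hk₁
  set k₂ := drawnKind g w (2 * e + 1) with hk₂
  have hX₁ : ∀ l, X w s s.fst l = w (.reward k₁ (2 * e) l) := by
    intro l
    rw [X, he.fst_eq, h.kind_eq _ (by rw [he.queries_eq]; omega)]
  have hX₂ : ∀ l, X w s s.snd l = w (.reward k₂ (2 * e + 1) l) := by
    intro l
    rw [X, he.snd_eq, h.kind_eq _ (by rw [he.queries_eq]; omega)]
  have hrej : ¬ Rejects w k₁ k₂ e s.m := by
    have := hd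
    unfold Discards at this
    simp only [hX₁, hX₂] at this
    exact this
  set N₁ := s.pulls (2 * e) with hN₁
  set N₂ := s.pulls (2 * e + 1) with hN₂
  have hcl := he.clock_eq
  have hm := he.m_eq
  have hmp := he.m_pos
  rw [← he_def, ← hN₁, ← hN₂] at hcl hm
  have hclN : s.clock ≤ N := h.clock_le.trans hn
  have hidx₁ : ucbIndex w s s.fst =
      (∑ l ∈ Finset.range N₁, w (.reward k₁ (2 * e + 0) l)) / N₁ +
        √(2 * Real.log s.clock / N₁) := by
    simp only [ucbIndex, hX₁]
    rw [he.fst_eq, ← he_def, ← hN₁, add_zero]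
  have hidx₂ : ucbIndex w s s.snd =
      (∑ l ∈ Finset.range N₂, w (.reward k₂ (2 * e + 1) l)) / N₂ +
        √(2 * Real.log s.clock / N₂) := by
    simp only [ucbIndex, hX₂]
    rw [he.snd_eq, ← he_def, ← hN₂]
  have hdc : devCount mean w e s.clock ≤ devCount mean w e (s.clock + 1) :=
    devCount_mono mean w e (Nat.le_succ s.clock)
  have hdc' : (devCount mean w e s.clock : ℝ) ≤ devCount mean w e (s.clock + 1) := by
    exact_mod_cast hdc
  have hLc := hL s.clock hc hclN
  have main₁ : ucbIndex w s s.snd ≤ ucbIndex w s s.fst →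
      (devCount mean w e (s.clock + 1) = devCount mean w e s.clock + 1) ∨
      ((k₁ = k₂ → N₁ ≤ 225 * N₂) ∧ (k₁ = .inferior → k₂ = .optimal → (N₁ : ℝ) ≤ L)) := by
    intro hle
    by_cases hdev : Deviates mean w e s.clock
    · exact .inl (devCount_succ_of_deviates hdev)
    · rw [hidx₁, hidx₂] at hle
      obtain ⟨p, q⟩ := chosen_le_of_not_deviates hΔ hc hdev (by omega) (by omega) (by omega)
        (by omega) (by omega) (by omega) hle
      exact .inr ⟨p, fun a b => (q a b).trans hLc⟩
  have main₂ : ucbIndex w s s.fst ≤ ucbIndex w s s.snd →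
      (devCount mean w e (s.clock + 1) = devCount mean w e s.clock + 1) ∨
      ((k₂ = k₁ → N₂ ≤ 225 * N₁) ∧ (k₂ = .inferior → k₁ = .optimal → (N₂ : ℝ) ≤ L)) := by
    intro hle
    by_cases hdev : Deviates mean w e s.clock
    · exact .inl (devCount_succ_of_deviates hdev)
    · rw [hidx₁, hidx₂] at hle
      obtain ⟨p, q⟩ := chosen_le_of_not_deviates hΔ hc hdev (by omega) (by omega) (by omega)
        (by omega) (by omega) (by omega) hle
      exact .inr ⟨p, fun a b => (q a b).trans hLc⟩
  have hbal := he.balanced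
  have hfl := he.fst_le
  have hsl := he.snd_le
  rw [← he_def, ← hk₁, ← hk₂, ← hN₁, ← hN₂] at hbal
  rw [← he_def, ← hk₁, ← hk₂, ← hN₁] at hfl
  rw [← he_def, ← hk₁, ← hk₂, ← hN₂] at hsl
  set s' := refresh (pull w n (ucbArm tie w n s) s) with hs'
  -- The test just passed was at sample count `s.m`, so the list of passed counts extends by one,
  -- which is as much as `m` can grow.
  have hkept : ∀ i < s.m + 1, ¬ Rejects w k₁ k₂ e i := by
    intro i hi
    rcases Nat.lt_succ_iff_lt_or_eq.1 hi with hi | rfl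
    · exact he.kept i hi
    · exact hrej
  have hs'm : s'.m = if s.m < min (s'.pulls (2 * e)) (s'.pulls (2 * e + 1)) then s.m + 1
      else s.m := by
    rw [hs']
    change (if s.m < min ((pull w n (ucbArm tie w n s) s).pulls s.fst)
      ((pull w n (ucbArm tie w n s) s).pulls s.snd) then s.m + 1 else s.m) = _
    rw [he.fst_eq, he.snd_eq]
    rfl
  have hs'c : s'.clock = s.clock + 1 := rfl
  have key : ((s'.pulls (2 * e) = N₁ + 1 ∧ s'.pulls (2 * e + 1) = N₂) ∧
      ((devCount mean w e (s.clock + 1) = devCount mean w e s.clock + 1) ∨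
      ((k₁ = k₂ → N₁ ≤ 225 * N₂) ∧ (k₁ = .inferior → k₂ = .optimal → (N₁ : ℝ) ≤ L)))) ∨
      ((s'.pulls (2 * e) = N₁ ∧ s'.pulls (2 * e + 1) = N₂ + 1) ∧
      ((devCount mean w e (s.clock + 1) = devCount mean w e s.clock + 1) ∨
      ((k₂ = k₁ → N₂ ≤ 225 * N₁) ∧ (k₂ = .inferior → k₁ = .optimal → (N₂ : ℝ) ≤ L)))) := by
    have hpl : s'.pulls = Function.update s.pulls (ucbArm tie w n s)
      (s.pulls (ucbArm tie w n s) + 1) := rfl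
    rcases ucbArm_cases tie w n s with ⟨hb, hle⟩ | ⟨hb, hle⟩
    · left
      refine ⟨?_, main₁ hle⟩
      rw [hpl, hb, he.fst_eq, Function.update_self, Function.update_of_ne (by omega)]
      exact ⟨rfl, rfl⟩
    · right
      refine ⟨?_, main₂ hle⟩
      rw [hpl, hb, he.snd_eq, Function.update_self, Function.update_of_ne (by omega)]
      exact ⟨rfl, rfl⟩
  have hdev0 : (0 : ℝ) ≤ devCount mean w e s.clock := by positivity
  refine { queries_eq := he.queries_eq, fst_eq := he.fst_eq, snd_eq := he.snd_eq,
           clock_eq := ?_, m_eq := ?_, m_pos := ?_, kept := ?_, balanced := ?_,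
           fst_le := ?_, snd_le := ?_ }
  · change s'.pulls (2 * e) + s'.pulls (2 * e + 1) = _
    rcases key with ⟨⟨p, q⟩, -⟩ | ⟨⟨p, q⟩, -⟩ <;> omega
  · change _ = min (s'.pulls (2 * e)) (s'.pulls (2 * e + 1))
    rw [hs'm]
    rcases key with ⟨⟨p, q⟩, -⟩ | ⟨⟨p, q⟩, -⟩ <;> rw [p, q] <;> split_ifs <;> omega
  · rw [hs'm]; split_ifs <;> omega
  · intro i hi
    exact hkept i (by rw [hs'm] at hi; split_ifs at hi <;> omega)
  · intro e₁ e₂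
    change s'.pulls (2 * e) ≤ 225 * s'.pulls (2 * e + 1) + 1 + devCount mean w e (s.clock + 1) ∧
      s'.pulls (2 * e + 1) ≤ 225 * s'.pulls (2 * e) + 1 + devCount mean w e (s.clock + 1)
    have hb := hbal e₁ e₂
    have hkk : k₁ = k₂ := by rw [hk₁, hk₂]; exact e₁.trans e₂.symm
    rcases key with ⟨⟨p, q⟩, r | ⟨r, -⟩⟩ | ⟨⟨p, q⟩, r | ⟨r, -⟩⟩
    · omega
    · have := r hkk; omega
    · omega
    · have := r hkk.symm; omega
  · intro e₁ e₂
    change (s'.pulls (2 * e) : ℝ) ≤ L + 1 + devCount mean w e (s.clock + 1)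
    have hb := hfl e₁ e₂
    rcases key with ⟨⟨p, -⟩, r | ⟨-, r⟩⟩ | ⟨⟨p, -⟩, -⟩
    · rw [p, r]; push_cast; linarith
    · rw [p]; push_cast; linarith [r e₁ e₂]
    · rw [p]; linarith
  · intro e₁ e₂
    change (s'.pulls (2 * e + 1) : ℝ) ≤ L + 1 + devCount mean w e (s.clock + 1)
    have hb := hsl e₁ e₂
    rcases key with ⟨⟨-, p⟩, -⟩ | ⟨⟨-, p⟩, r | ⟨-, r⟩⟩
    · rw [p]; linarith
    · rw [p, r]; push_cast; linarith
    · rw [p]; push_cast; linarith [r e₂ e₁]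

lemma inv_ucb {mean : ArmType → ℝ} {g : ℕ → ℝ} {tie : TieRule} {L : ℝ} {N n : ℕ}
    {w : Source → ℝ} {s : State} (hΔ : mean .inferior < mean .optimal)
    (hL : ∀ t : ℕ, 2 ≤ t → t ≤ N →
      8 * Real.log t / (mean .optimal - mean .inferior) ^ 2 ≤ L)
    (hn : n ≤ N) (h : Inv mean g L N w n s) (hc : 2 ≤ s.clock) (hd : ¬ Discards w s) :
    Inv mean g L N w (n + 1) (refresh (pull w n (ucbArm tie w n s) s)) := by
  have he := h.two hc
  have hb : 2 * s.epoch ≤ ucbArm tie w n s ∧ ucbArm tie w n s < s.queries := by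
    have := he.fst_eq
    have := he.snd_eq
    have := he.queries_eq
    rcases ucbArm_cases tie w n s with ⟨hb, -⟩ | ⟨hb, -⟩ <;> omega
  refine { kind_eq := h.kind_eq, pulls_zero := ?_, epoch_le := h.epoch_le.trans (by omega),
           clock_le := ?_, abandoned := h.abandoned, past := ?_, zero := ?_, one := ?_, two := ?_ }
  · intro a ha
    have ha' : s.queries ≤ a := ha
    change Function.update s.pulls _ _ a = 0
    rw [Function.update_of_ne (by omega)]; exact h.pulls_zero a ha'
  · change s.clock + 1 ≤ n + 1
    have := h.clock_le; omega
  · intro e' he'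
    have he'' : e' < s.epoch := he'
    rw [infPulls_update_of_le (s := s) (b := ucbArm tie w n s) rfl (by omega)]
    exact h.past e' he''
  · intro hc'; exact absurd (show s.clock + 1 = 0 from hc') (by omega)
  · intro hc'; exact absurd (show s.clock + 1 = 1 from hc') (by omega)
  · intro _; exact epochInv_ucb hΔ hL hn h hc hd

lemma inv_run {mean : ArmType → ℝ} {g : ℕ → ℝ} (tie : TieRule) {L : ℝ} {N : ℕ}
    (w : Source → ℝ) (hΔ : mean .inferior < mean .optimal) (hL0 : 0 ≤ L)
    (hL : ∀ t : ℕ, 2 ≤ t → t ≤ N →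
      8 * Real.log t / (mean .optimal - mean .inferior) ^ 2 ≤ L) (n : ℕ) (hn : n ≤ N) :
    Inv mean g L N w n (run g tie w n) := by
  classical
  induction n with
  | zero =>
    refine { kind_eq := ?_, pulls_zero := ?_, epoch_le := le_rfl, clock_le := le_rfl,
             abandoned := ?_, past := ?_, zero := ?_, one := ?_, two := ?_ } <;>
      simp [run, State.init]
  | succ n ih =>
    have h := ih (by omega)
    rw [run, step]
    set s := run g tie w n
    split_ifs with h0 h1 h2
    · exact inv_playFirst { h.toBaseInv with
        epoch_le := h.epoch_le.trans (by omega), clock_le := h.clock_le.trans (by omega) }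
        (h.zero h0)
    · exact inv_playSecond hL0 h h1
    · have he := h.two (by omega)
      refine inv_playFirst
        { kind_eq := h.kind_eq, pulls_zero := h.pulls_zero, epoch_le := ?_,
          clock_le := h.clock_le.trans (by omega), abandoned := ?_, past := ?_ } ?_
      · have := h.epoch_le
        change s.epoch + 1 ≤ n + 1; omega
      · intro e hlt
        rcases Nat.lt_succ_iff_lt_or_eq.1 (show e < s.epoch + 1 from hlt) with hlt | rfl
        · exact h.abandoned e hlt
        -- The sample count at which the test has just failed witnesses that the epoch is abandoned.
        · refine ⟨s.m, ?_⟩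
          unfold Discards at h2
          simp only [X, he.fst_eq, he.snd_eq] at h2
          rw [h.kind_eq _ (by rw [he.queries_eq]; omega),
            h.kind_eq _ (by rw [he.queries_eq]; omega)] at h2
          exact h2
      · intro e hlt
        rcases Nat.lt_succ_iff_lt_or_eq.1 (show e < s.epoch + 1 from hlt) with hlt | rfl
        · exact h.past e hlt
        · exact le_epochBound_of_epochInv (n := n) (by omega) h.toBaseInv he
      · change s.queries = 2 * (s.epoch + 1)
        rw [he.queries_eq]; ring
    · exact inv_ucb hΔ hL (by omega) h (by omega) h2

lemma epochBound_nonneg {mean : ArmType → ℝ} {g : ℕ → ℝ} {L : ℝ} {N : ℕ} {w : Source → ℝ}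
    {e : ℕ} (hL : 0 ≤ L) : 0 ≤ epochBound mean g L N w e := by
  unfold epochBound
  split_ifs <;> positivity

lemma one_le_epochBound {mean : ArmType → ℝ} {g : ℕ → ℝ} {L : ℝ} {N : ℕ} {w : Source → ℝ}
    {e : ℕ} (hL : 0 ≤ L) : 1 ≤ epochBound mean g L N w e := by
  unfold epochBound
  have : (0 : ℝ) ≤ keepCount w e N := by positivity
  have : (0 : ℝ) ≤ devCount mean w e N := by positivity
  split_ifs <;> linarith

lemma sum_range_two_mul (F : ℕ → ℝ) (n : ℕ) :
    ∑ a ∈ Finset.range (2 * n), F a = ∑ e ∈ Finset.range n, (F (2 * e) + F (2 * e + 1)) := by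
  induction n with
  | zero => simp
  | succ n ih =>
    rw [show 2 * (n + 1) = 2 * n + 1 + 1 by ring, Finset.sum_range_succ, Finset.sum_range_succ,
      Finset.sum_range_succ, ih]
    ring

open Classical in
/-- The number of plays of inferior arms is bounded by the sum of the epoch bounds over the epochs
that are reached. -/
lemma sum_played_inferior_le {mean : ArmType → ℝ} {g : ℕ → ℝ} (tie : TieRule) {L : ℝ} {N : ℕ}
    (w : Source → ℝ) (hΔ : mean .inferior < mean .optimal) (hL0 : 0 ≤ L)
    (hL : ∀ t : ℕ, 2 ≤ t → t ≤ N →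
      8 * Real.log t / (mean .optimal - mean .inferior) ^ 2 ≤ L) :
    ∑ t ∈ Finset.range N, (if drawnKind g w (played g tie w t) = .inferior then (1 : ℝ) else 0) ≤
      ∑ e ∈ Finset.range (N + 1),
        (if ∀ i < e, Abandoned g w i then (1 : ℝ) else 0) * epochBound mean g L N w e := by
  have inv := fun n hn => inv_run (g := g) tie w hΔ hL0 hL n hn
  have hq : ∀ n ≤ N, (run g tie w n).queries ≤ 2 * (run g tie w n).epoch + 2 := by
    intro n hn
    have h := inv n hn
    rcases Nat.lt_or_ge (run g tie w n).clock 2 with hc | hc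
    · interval_cases hcl : (run g tie w n).clock
      · have := h.zero hcl; omega
      · have := h.one hcl; omega
    · have := (h.two hc).queries_eq; omega
  have hplayed : ∀ t < N, played g tie w t < 2 * (N + 1) := by
    intro t ht
    have h := inv (t + 1) ht
    have h1 : (run g tie w (t + 1)).pulls (played g tie w t) ≠ 0 := by
      rw [run, step_pulls, played]; simp
    have h2 : played g tie w t < (run g tie w (t + 1)).queries := by
      by_contra hcon
      exact h1 (h.pulls_zero _ (not_lt.1 hcon))
    have := hq (t + 1) ht
    have := h.epoch_le
    omega
  rw [sum_played g tie w (fun a => if drawnKind g w a = .inferior then (1 : ℝ) else 0) _ _ hplayed,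
    sum_range_two_mul]
  refine Finset.sum_le_sum fun e _ => ?_
  set s := run g tie w N with hs
  have h := inv N le_rfl
  rw [← hs] at h
  have hq' := hq N le_rfl
  rw [← hs] at hq'
  have hinf : (s.pulls (2 * e) : ℝ) * (if drawnKind g w (2 * e) = .inferior then (1 : ℝ) else 0) +
      s.pulls (2 * e + 1) * (if drawnKind g w (2 * e + 1) = .inferior then (1 : ℝ) else 0) =
      infPulls g w s e := by
    unfold infPulls
    push_cast
    simp
  rw [hinf]
  rcases lt_trichotomy e s.epoch with he | he | he
  · rw [if_pos fun i hi => h.abandoned i (hi.trans he), one_mul]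
    exact h.past e he
  · subst he
    rw [if_pos fun i hi => h.abandoned i hi, one_mul]
    rcases Nat.lt_or_ge s.clock 2 with hc | hc
    -- Before its second round an epoch has had at most one pull, which the summand `1` of
    -- `epochBound` covers.
    · refine le_trans ?_ (one_le_epochBound hL0)
      unfold infPulls
      interval_cases hcl : s.clock
      · have := h.zero hcl
        rw [h.pulls_zero _ (by omega), h.pulls_zero _ (by omega)]
        simp
      · obtain ⟨h1, h2, h3⟩ := h.one hcl
        rw [h3, h.pulls_zero _ (by omega)]
        split_ifs <;> simp
    · exact le_epochBound_of_epochInv le_rfl h.toBaseInv (h.two hc)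
  · have : infPulls g w s e = 0 := by
      unfold infPulls
      rw [h.pulls_zero _ (by omega), h.pulls_zero _ (by omega)]
      simp
    rw [this]
    have := epochBound_nonneg (mean := mean) (g := g) (N := N) (w := w) (e := e) hL0
    split_ifs <;> simp [this]

/-! ### The choice of an arm does not depend on its future rewards -/

/-- The test therefore reads only rewards that have already been observed. The value of `L` is
immaterial here and is chosen just to make `inv_run` applicable. -/
lemma m_le_pulls {mean : ArmType → ℝ} (g : ℕ → ℝ) (tie : TieRule) (w : Source → ℝ)
    (hΔ : mean .inferior < mean .optimal) (n : ℕ) (hc : 2 ≤ (run g tie w n).clock) :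
    (run g tie w n).m ≤ (run g tie w n).pulls (run g tie w n).fst ∧
      (run g tie w n).m ≤ (run g tie w n).pulls (run g tie w n).snd := by
  have h := (inv_run (mean := mean) (g := g) (L := 8 * Real.log n /
    (mean .optimal - mean .inferior) ^ 2) tie w hΔ
    (by have := Real.log_natCast_nonneg n; positivity) (fun t h2 ht => by
      gcongr) n le_rfl).two hc
  rw [h.fst_eq, h.snd_eq, h.m_eq]
  exact ⟨min_le_left _ _, min_le_right _ _⟩

section Congr

variable {g : ℕ → ℝ} {tie : TieRule} {w w' : Source → ℝ} {k : ArmType} {a j t : ℕ} {s : State}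

lemma sum_X_congr (hw : ∀ r, r ≠ .reward k a j → w' r = w r) (ha : s.pulls a ≤ j) {b n : ℕ}
    (hn : n ≤ s.pulls b) :
    ∀ i ∈ Finset.range n, X w' s b i = X w s b i := by
  intro i hi
  refine hw _ fun h => ?_
  have hi' := Finset.mem_range.1 hi
  simp only [Source.reward.injEq] at h
  obtain ⟨-, rfl, rfl⟩ := h
  omega

lemma discards_congr (hw : ∀ r, r ≠ .reward k a j → w' r = w r) (ha : s.pulls a ≤ j)
    (hm : s.m ≤ s.pulls s.fst ∧ s.m ≤ s.pulls s.snd) : Discards w' s ↔ Discards w s := by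
  unfold Discards
  rw [hw _ (by simp), Finset.sum_congr rfl fun i hi => by
    rw [sum_X_congr hw ha hm.1 i hi, sum_X_congr hw ha hm.2 i hi]]

lemma ucbArm_congr (hw : ∀ r, r ≠ .reward k a j → w' r = w r) (ha : s.pulls a ≤ j) :
    ucbArm tie w' t s = ucbArm tie w t s := by
  have h : ∀ b, ucbIndex w' s b = ucbIndex w s b := fun b => by
    unfold ucbIndex
    rw [Finset.sum_congr rfl (sum_X_congr hw ha le_rfl)]
  unfold ucbArm
  rw [h, h, hw (.coin t) (by simp)]

lemma chosenArm_congr (hw : ∀ r, r ≠ .reward k a j → w' r = w r) (ha : s.pulls a ≤ j)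
    (hm : 2 ≤ s.clock → s.m ≤ s.pulls s.fst ∧ s.m ≤ s.pulls s.snd) :
    chosenArm tie w' t s = chosenArm tie w t s := by
  classical
  unfold chosenArm
  rw [ucbArm_congr hw ha]
  rcases Nat.lt_or_ge s.clock 2 with hc | hc
  · simp [hc]
  · exact if_congr (or_congr Iff.rfl (discards_congr hw ha (hm hc))) rfl rfl

lemma pull_congr (hw : ∀ r, r ≠ .reward k a j → w' r = w r) {b : ℕ}
    (hb : (pull w t b s).pulls a ≤ j) : pull w' t b s = pull w t b s := by
  unfold pull
  -- If the reward collected were the altered one, the count of `a` after the pull would be `j + 1`,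
  -- contrary to `hb`.
  have : X w' s b (s.pulls b) = X w s b (s.pulls b) := by
    refine hw _ fun h => ?_
    simp only [Source.reward.injEq] at h
    obtain ⟨-, rfl, rfl⟩ := h
    simp [pull] at hb
  rw [this]

lemma query_congr (hw : ∀ r, r ≠ .reward k a j → w' r = w r) : query g w' s = query g w s := by
  unfold query
  rw [hw _ (by simp)]

lemma step_congr (hw : ∀ r, r ≠ .reward k a j → w' r = w r)
    (ha : (step g tie w t s).pulls a ≤ j)
    (hm : 2 ≤ s.clock → s.m ≤ s.pulls s.fst ∧ s.m ≤ s.pulls s.snd) :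
    step g tie w' t s = step g tie w t s := by
  have ha' : s.pulls a ≤ j := by
    rw [step_pulls] at ha
    refine le_trans ?_ ha
    by_cases h : a = chosenArm tie w t s
    · rw [← h]; simp
    · simp [h]
  unfold step at ha ⊢
  by_cases h0 : s.clock = 0
  · simp only [if_pos h0] at ha ⊢
    unfold playFirst at ha ⊢
    rw [query_congr hw, pull_congr hw ha]
  by_cases h1 : s.clock = 1
  · simp only [if_neg h0, if_pos h1] at ha ⊢
    unfold playSecond at ha ⊢
    rw [query_congr hw, pull_congr hw ha]
  have hd := discards_congr hw ha' (hm (by omega))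
  by_cases h2 : Discards w s
  · simp only [if_neg h0, if_neg h1, if_pos h2, if_pos (hd.2 h2)] at ha ⊢
    unfold playFirst at ha ⊢
    rw [query_congr hw, pull_congr hw ha]
  · simp only [if_neg h0, if_neg h1, if_neg h2, if_neg (mt hd.1 h2)] at ha ⊢
    rw [ucbArm_congr hw ha', pull_congr hw (b := ucbArm tie w t s) ha]

end Congr

lemma run_pulls_mono (g : ℕ → ℝ) (tie : TieRule) (w : Source → ℝ) (t a : ℕ) :
    (run g tie w t).pulls a ≤ (run g tie w (t + 1)).pulls a := by
  rw [run, step_pulls]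
  by_cases h : a = chosenArm tie w t (run g tie w t)
  · rw [← h]; simp
  · simp [h]

/-- As long as the arm `a` has been pulled at most `j` times, the reward of its `(j + 1)`-st pull
has never been read. This replaces a filtration argument. -/
lemma run_congr {mean : ArmType → ℝ} {g : ℕ → ℝ} {tie : TieRule} {w w' : Source → ℝ}
    {k : ArmType} {a j : ℕ} (hΔ : mean .inferior < mean .optimal)
    (hw : ∀ r, r ≠ .reward k a j → w' r = w r) (t : ℕ) (ha : (run g tie w t).pulls a ≤ j) :
    run g tie w' t = run g tie w t := by
  induction t with
  | zero => rfl
  | succ t ih =>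
    rw [run, run, ih ((run_pulls_mono g tie w t a).trans ha)]
    exact step_congr hw ha (m_le_pulls g tie w hΔ t)

/-- The event that round `t` sees the `(j + 1)`-st pull of the arm `a`, which is of type `k`. -/
def PullsAt (g : ℕ → ℝ) (tie : TieRule) (t : ℕ) (k : ArmType) (a j : ℕ) (w : Source → ℝ) : Prop :=
  played g tie w t = a ∧ (run g tie w t).pulls a = j ∧ drawnKind g w a = k

lemma pullsAt_congr {mean : ArmType → ℝ} {g : ℕ → ℝ} {tie : TieRule} {w w' : Source → ℝ}
    {k : ArmType} {a j t : ℕ} (hΔ : mean .inferior < mean .optimal)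
    (hw : ∀ r, r ≠ .reward k a j → w' r = w r) (h : PullsAt g tie t k a j w) :
    PullsAt g tie t k a j w' := by
  obtain ⟨h1, h2, h3⟩ := h
  have hr := run_congr (g := g) (tie := tie) hΔ hw t h2.le
  refine ⟨?_, by rw [hr, h2], ?_⟩
  · rw [played, hr, chosenArm_congr hw h2.le (m_le_pulls g tie w hΔ t)]
    exact h1
  · rw [← h3]
    unfold drawnKind
    rw [hw _ (by simp)]

/-- The reward obtained in round `t`. -/
def earned (g : ℕ → ℝ) (tie : TieRule) (t : ℕ) (w : Source → ℝ) : ℝ :=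
  w (.reward (drawnKind g w (played g tie w t)) (played g tie w t)
    ((run g tie w t).pulls (played g tie w t)))

/-- An arm that is played has been queried, and the type stored for a queried arm is the one drawn
from its mark; a past observation is never overwritten. -/
lemma run_obs {mean : ArmType → ℝ} {g : ℕ → ℝ} {tie : TieRule} {w : Source → ℝ}
    (hΔ : mean .inferior < mean .optimal) {t n : ℕ} (h : t < n) :
    (run g tie w n).obs t = (played g tie w t, earned g tie t w) := by
  induction n with
  | zero => omega
  | succ n ih =>
    rw [run, step_obs]
    rcases Nat.lt_succ_iff_lt_or_eq.1 h with h | rfl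
    · rw [Function.update_of_ne h.ne, ih h]
    · rw [Function.update_self, earned]
      have hi := inv_run (mean := mean) (g := g) (L := 8 * Real.log ((t + 1 : ℕ) : ℝ) /
        (mean .optimal - mean .inferior) ^ 2) tie w hΔ
        (by have := Real.log_natCast_nonneg (t + 1); positivity) (fun t h2 ht => by
        gcongr) (t + 1) le_rfl
      have hq : played g tie w t < (run g tie w (t + 1)).queries := by
        by_contra hcon
        have := hi.pulls_zero _ (not_lt.1 hcon)
        rw [run, step_pulls] at this
        simp [played] at this
      have hk := hi.kind_eq _ hq
      rw [run] at hk
      rw [← hk]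
      rfl

lemma played_le (g : ℕ → ℝ) (tie : TieRule) (w : Source → ℝ) {mean : ArmType → ℝ}
    (hΔ : mean .inferior < mean .optimal) (t : ℕ) : played g tie w t ≤ 2 * t + 2 := by
  have inv := inv_run (mean := mean) (g := g) (L := 8 * Real.log ((t : ℕ) : ℝ) /
    (mean .optimal - mean .inferior) ^ 2) tie w hΔ
    (by have := Real.log_natCast_nonneg t; positivity) (fun t h2 ht => by gcongr) t le_rfl
  have he := inv.epoch_le
  have hq : (run g tie w t).queries ≤ 2 * (run g tie w t).epoch + 2 := by
    rcases Nat.lt_or_ge (run g tie w t).clock 2 with hc | hc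
    · interval_cases hcl : (run g tie w t).clock
      · have := inv.zero hcl; omega
      · have := inv.one hcl; omega
    · have := (inv.two hc).queries_eq; omega
  unfold played chosenArm
  split_ifs with h
  · omega
  · have h2 := inv.two (by omega)
    have := h2.fst_eq
    have := h2.snd_eq
    rcases ucbArm_cases tie w t (run g tie w t) with ⟨hb, -⟩ | ⟨hb, -⟩ <;> omega

lemma run_pulls_le (g : ℕ → ℝ) (tie : TieRule) (w : Source → ℝ) (t a : ℕ) :
    (run g tie w t).pulls a ≤ t := by
  induction t with
  | zero => simp [run, State.init]
  | succ t ih =>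
    rw [run, step_pulls]
    by_cases h : a = chosenArm tie w t (run g tie w t)
    · rw [← h]; simp [ih]
    · simp [h]; omega

/-! ### Measurability -/

instance : MeasurableSpace ArmType := ⊤
instance : DiscreteMeasurableSpace ArmType := ⟨fun _ => trivial⟩
instance : Finite ArmType := Finite.of_injective (fun k : ArmType => decide (k = .optimal)) (by
  intro a b h
  cases a <;> cases b <;> simp_all)
instance : MeasurableSpace Source := ⊤
instance : DiscreteMeasurableSpace Source := ⟨fun _ => trivial⟩
instance : Countable Source := by
  refine Function.Injective.countable (β := ℕ × Bool × ℕ × ℕ) (f := fun s => match s with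
    | .mark a => (0, false, a, 0)
    | .reward k a j => (1, decide (k = .optimal), a, j)
    | .noise e => (2, false, e, 0)
    | .coin t => (3, false, t, 0)) ?_
  rintro (a | ⟨_ | _, a, j⟩ | e | t) (a' | ⟨_ | _, a', j'⟩ | e' | t') h <;> simp_all

/-- The random labels of the algorithm (arms, counts, epochs) take countably many values, so a
random label may be substituted into a family of measurable functions. -/
lemma measurable_apply_countable {ι α β : Type*} [Countable ι] [MeasurableSpace ι]
    [DiscreteMeasurableSpace ι] [MeasurableSpace α] [MeasurableSpace β] {f : ι → α → β}
    (hf : ∀ i, Measurable (f i)) {b : α → ι} (hb : Measurable b) :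
    Measurable fun x => f (b x) x :=
  (measurable_from_prod_countable_right (f := fun p : ι × α => f p.1 p.2) hf).comp
    (hb.prodMk measurable_id)

lemma measurable_drawnKind (g : ℕ → ℝ) (a : ℕ) : Measurable fun w => drawnKind g w a := by
  classical
  unfold drawnKind
  exact Measurable.ite (measurableSet_lt (measurable_pi_apply _) measurable_const)
    measurable_const measurable_const

lemma measurable_reward {k : (Source → ℝ) → ArmType} {a j : (Source → ℝ) → ℕ}
    (hk : Measurable k) (ha : Measurable a) (hj : Measurable j) :
    Measurable fun w : Source → ℝ => w (.reward (k w) (a w) (j w)) :=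
  measurable_apply_countable (f := fun (s : Source) (w : Source → ℝ) => w s)
    (fun s => measurable_pi_apply s)
    ((Measurable.of_discrete (f := fun p : ArmType × ℕ × ℕ => Source.reward p.1 p.2.1 p.2.2)).comp
      (hk.prodMk (ha.prodMk hj)))

/-- All components of the situation depend measurably on the randomness. -/
structure MeasurableState (F : (Source → ℝ) → State) : Prop where
  queries : Measurable fun w => (F w).queries
  kind : ∀ a, Measurable fun w => (F w).kind a
  pulls : ∀ a, Measurable fun w => (F w).pulls a
  obs : Measurable fun w => (F w).obs
  epoch : Measurable fun w => (F w).epoch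
  clock : Measurable fun w => (F w).clock
  fst : Measurable fun w => (F w).fst
  snd : Measurable fun w => (F w).snd
  m : Measurable fun w => (F w).m

namespace MeasurableState

variable {F G : (Source → ℝ) → State} {g : ℕ → ℝ} {tie : TieRule} {t : ℕ}

lemma pulls_apply (hF : MeasurableState F) {b : (Source → ℝ) → ℕ} (hb : Measurable b) :
    Measurable fun w => (F w).pulls (b w) :=
  measurable_apply_countable (f := fun a w => (F w).pulls a) hF.pulls hb

lemma X (hF : MeasurableState F) {a j : (Source → ℝ) → ℕ} (ha : Measurable a)
    (hj : Measurable j) : Measurable fun w => Bandit.X w (F w) (a w) (j w) :=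
  measurable_reward (measurable_apply_countable (f := fun a w => (F w).kind a) hF.kind ha) ha hj

lemma sum_X (hF : MeasurableState F) {a n : (Source → ℝ) → ℕ} (ha : Measurable a)
    (hn : Measurable n) : Measurable fun w => ∑ j ∈ Finset.range (n w), Bandit.X w (F w) (a w) j :=
  measurable_apply_countable
    (f := fun (n : ℕ) w => ∑ j ∈ Finset.range n, Bandit.X w (F w) (a w) j)
    (fun _ => Finset.measurable_sum _ fun _ _ => hF.X ha measurable_const) hn

lemma ite (hF : MeasurableState F) (hG : MeasurableState G) {p : (Source → ℝ) → Prop}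
    [DecidablePred p] (hp : MeasurableSet {w | p w}) :
    MeasurableState fun w => if p w then F w else G w where
  queries := by
    simp only [apply_ite State.queries]; exact Measurable.ite hp hF.queries hG.queries
  kind a := by
    simp only [apply_ite (fun s : State => s.kind a)]
    exact Measurable.ite hp (hF.kind a) (hG.kind a)
  pulls a := by
    simp only [apply_ite (fun s : State => s.pulls a)]
    exact Measurable.ite hp (hF.pulls a) (hG.pulls a)
  obs := by simp only [apply_ite State.obs]; exact Measurable.ite hp hF.obs hG.obs
  epoch := by simp only [apply_ite State.epoch]; exact Measurable.ite hp hF.epoch hG.epoch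
  clock := by simp only [apply_ite State.clock]; exact Measurable.ite hp hF.clock hG.clock
  fst := by simp only [apply_ite State.fst]; exact Measurable.ite hp hF.fst hG.fst
  snd := by simp only [apply_ite State.snd]; exact Measurable.ite hp hF.snd hG.snd
  m := by simp only [apply_ite State.m]; exact Measurable.ite hp hF.m hG.m

lemma pull (hF : MeasurableState F) {b : (Source → ℝ) → ℕ} (hb : Measurable b) :
    MeasurableState fun w => Bandit.pull w t (b w) (F w) where
  queries := hF.queries
  kind := hF.kind
  pulls a := by
    simp only [Bandit.pull, Function.update_apply]
    exact Measurable.ite (measurableSet_eq_fun measurable_const hb)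
      ((hF.pulls_apply hb).add_const 1) (hF.pulls a)
  obs := by
    simp only [Bandit.pull]
    refine measurable_pi_iff.2 fun i => ?_
    simp only [Function.update_apply]
    exact Measurable.ite (by simp) (hb.prodMk (hF.X hb (hF.pulls_apply hb)))
      ((measurable_pi_apply i).comp hF.obs)
  epoch := hF.epoch
  clock := hF.clock.add_const 1
  fst := hF.fst
  snd := hF.snd
  m := hF.m

lemma query (hF : MeasurableState F) : MeasurableState fun w => Bandit.query g w (F w) where
  queries := hF.queries.add_const 1
  kind a := by
    classical
    simp only [Bandit.query, Function.update_apply]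
    refine Measurable.ite (measurableSet_eq_fun measurable_const hF.queries) ?_ (hF.kind a)
    exact measurable_apply_countable
      (f := fun q w => drawnKind g w q) (measurable_drawnKind g) hF.queries
  pulls := hF.pulls
  obs := hF.obs
  epoch := hF.epoch
  clock := hF.clock
  fst := hF.fst
  snd := hF.snd
  m := hF.m

lemma playFirst (hF : MeasurableState F) : MeasurableState fun w => Bandit.playFirst g w t (F w) :=
  pull (F := fun w => { Bandit.query g w (F w) with fst := (F w).queries, clock := 0 })
    { hF.query (g := g) with fst := hF.queries, clock := measurable_const } hF.queries

lemma playSecond (hF : MeasurableState F) :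
    MeasurableState fun w => Bandit.playSecond g w t (F w) :=
  pull (F := fun w => { Bandit.query g w (F w) with snd := (F w).queries, m := 1 })
    { hF.query (g := g) with snd := hF.queries, m := measurable_const } hF.queries

lemma refresh (hF : MeasurableState F) : MeasurableState fun w => Bandit.refresh (F w) :=
  { hF with
    m := Measurable.ite (measurableSet_lt hF.m
      ((hF.pulls_apply hF.fst).min (hF.pulls_apply hF.snd))) (hF.m.add_const 1) hF.m }

lemma discards (hF : MeasurableState F) : MeasurableSet {w | Discards w (F w)} := by
  unfold Discards
  have hm : Measurable fun w => ((F w).m : ℝ) := measurable_from_nat.comp hF.m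
  refine measurableSet_lt ?_ ((hm.mul hm.log).sqrt.const_mul 4)
  have hn : Measurable fun w : Source → ℝ => w (.noise (F w).epoch) :=
    measurable_apply_countable (f := fun (e : ℕ) (w : Source → ℝ) => w (.noise e))
      (fun e => measurable_pi_apply _) hF.epoch
  simp only [Finset.sum_sub_distrib]
  exact (hn.add ((hF.sum_X hF.fst hF.m).sub (hF.sum_X hF.snd hF.m))).abs

lemma ucbIndex (hF : MeasurableState F) {a : (Source → ℝ) → ℕ} (ha : Measurable a) :
    Measurable fun w => Bandit.ucbIndex w (F w) (a w) := by
  have hp := hF.pulls_apply ha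
  have hp' : Measurable fun w => ((F w).pulls (a w) : ℝ) := measurable_from_nat.comp hp
  have hc : Measurable fun w => ((F w).clock : ℝ) := measurable_from_nat.comp hF.clock
  exact ((hF.sum_X ha hp).div hp').add ((hc.log.const_mul 2).div hp').sqrt

lemma ucbArm (hF : MeasurableState F)
    (htie : Measurable (fun p : (ℕ → ℕ × ℝ) × ℝ => tie t p.1 p.2)) :
    Measurable fun w => Bandit.ucbArm tie w t (F w) := by
  unfold Bandit.ucbArm
  refine Measurable.ite (measurableSet_lt (hF.ucbIndex hF.snd) (hF.ucbIndex hF.fst)) hF.fst ?_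
  refine Measurable.ite (measurableSet_lt (hF.ucbIndex hF.fst) (hF.ucbIndex hF.snd)) hF.snd ?_
  refine Measurable.ite ?_ hF.fst hF.snd
  exact (htie.comp (hF.obs.prodMk (measurable_pi_apply (Source.coin t))))
    (measurableSet_singleton true)

lemma step (hF : MeasurableState F)
    (htie : Measurable (fun p : (ℕ → ℕ × ℝ) × ℝ => tie t p.1 p.2)) :
    MeasurableState fun w => Bandit.step g tie w t (F w) := by
  classical
  unfold Bandit.step
  refine hF.playFirst.ite ?_ (measurableSet_eq_fun hF.clock measurable_const)
  refine hF.playSecond.ite ?_ (measurableSet_eq_fun hF.clock measurable_const)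
  refine MeasurableState.ite ?_ ?_ hF.discards
  · exact playFirst (F := fun w => { F w with epoch := (F w).epoch + 1 })
      { hF with epoch := hF.epoch.add_const 1 }
  · exact (hF.pull (hF.ucbArm htie)).refresh

lemma chosenArm (hF : MeasurableState F)
    (htie : Measurable (fun p : (ℕ → ℕ × ℝ) × ℝ => tie t p.1 p.2)) :
    Measurable fun w => Bandit.chosenArm tie w t (F w) := by
  unfold Bandit.chosenArm
  exact Measurable.ite ((measurableSet_lt hF.clock measurable_const).union hF.discards)
    hF.queries (hF.ucbArm htie)

end MeasurableState

lemma measurableState_run (g : ℕ → ℝ) {tie : TieRule}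
    (htie : ∀ t, Measurable (fun p : (ℕ → ℕ × ℝ) × ℝ => tie t p.1 p.2)) (n : ℕ) :
    MeasurableState fun w => run g tie w n := by
  induction n with
  | zero => constructor <;> intros <;> exact measurable_const
  | succ n ih => exact ih.step (htie n)

lemma measurable_played (g : ℕ → ℝ) {tie : TieRule}
    (htie : ∀ t, Measurable (fun p : (ℕ → ℕ × ℝ) × ℝ => tie t p.1 p.2)) (t : ℕ) :
    Measurable fun w => played g tie w t :=
  (measurableState_run g htie t).chosenArm (htie t)

lemma measurable_drawnKind_played (g : ℕ → ℝ) {tie : TieRule}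
    (htie : ∀ t, Measurable (fun p : (ℕ → ℕ × ℝ) × ℝ => tie t p.1 p.2)) (t : ℕ) :
    Measurable fun w => drawnKind g w (played g tie w t) :=
  measurable_apply_countable (f := fun a w => drawnKind g w a) (measurable_drawnKind g)
    (measurable_played g htie t)

lemma measurableSet_pullsAt (g : ℕ → ℝ) {tie : TieRule}
    (htie : ∀ t, Measurable (fun p : (ℕ → ℕ × ℝ) × ℝ => tie t p.1 p.2)) (t : ℕ) (k : ArmType)
    (a j : ℕ) : MeasurableSet {w | PullsAt g tie t k a j w} :=
  (measurableSet_eq_fun (measurable_played g htie t) measurable_const).inter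
    ((measurableSet_eq_fun ((measurableState_run g htie t).pulls a) measurable_const).inter
      (measurable_drawnKind g a (measurableSet_singleton k)))

/-! ### Independence of functions of disjoint sets of sources -/

/-- Setting all coordinates outside `U` to `0` does not change `H` and leaves a function of the
coordinates in `U` only. -/
lemma comap_le_of_dependsOn {Ω ι δ : Type*} [MeasurableSpace δ] {W : ι → Ω → ℝ}
    {H : (ι → ℝ) → δ} {U : Set ι} (hH : Measurable H) (hHU : DependsOn H U) :
    MeasurableSpace.comap (fun ω => H fun i => W i ω) inferInstance ≤
      ⨆ i ∈ U, MeasurableSpace.comap (W i) inferInstance := by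
  classical
  have : (fun ω => H fun i => W i ω) = fun ω => H fun i => if i ∈ U then W i ω else 0 := by
    funext ω
    exact hHU fun i hi => by simp [hi]
  rw [this]
  refine Measurable.comap_le ?_
  refine hH.comp ((@measurable_pi_iff _ _ _ (_) _ _).2 fun i => ?_)
  by_cases hi : i ∈ U
  · simp only [hi, if_true]
    exact (comap_measurable (W i)).mono (le_iSup₂_of_le i hi le_rfl) le_rfl
  · simp only [hi, if_false]
    exact measurable_const

lemma indepFun_of_dependsOn {Ω ι β γ : Type*} [MeasurableSpace Ω] {P : Measure Ω}
    [MeasurableSpace β] [MeasurableSpace γ] {W : ι → Ω → ℝ} (hm : ∀ i, Measurable (W i))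
    (hi : iIndepFun W P) {F : (ι → ℝ) → β} {G : (ι → ℝ) → γ} {S T : Set ι}
    (hF : Measurable F) (hG : Measurable G) (hFS : DependsOn F S) (hGT : DependsOn G T)
    (hST : Disjoint S T) :
    IndepFun (fun ω => F fun i => W i ω) (fun ω => G fun i => W i ω) P :=
  (IndepFun_iff_Indep _ _ _).2 <|
    indep_of_indep_of_le_left (indep_of_indep_of_le_right
      (indep_iSup_of_disjoint (fun i => (hm i).comap_le) ((iIndepFun_iff_iIndep _ _ _).1 hi) hST)
      (comap_le_of_dependsOn hG hGT)) (comap_le_of_dependsOn hF hFS)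

/-! ### The expected regret -/

/-- The event that this pull occurs in round `t` depends only on the other sources, by
`pullsAt_congr`, hence it is independent of the reward. -/
lemma integral_indicator_mul_reward {Ω : Type*} [MeasurableSpace Ω] {P : Measure Ω}
    [IsProbabilityMeasure P] {mean : ArmType → ℝ} {W : Source → Ω → ℝ}
    (hW : IsPrimitives P mean W) (hΔ : mean .inferior < mean .optimal) (g : ℕ → ℝ) {tie : TieRule}
    (htie : ∀ t, Measurable (fun p : (ℕ → ℕ × ℝ) × ℝ => tie t p.1 p.2)) (t : ℕ) (k : ArmType)
    (a j : ℕ) :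
    ∫ ω, {w | PullsAt g tie t k a j w}.indicator 1 (fun s => W s ω) * W (.reward k a j) ω ∂P =
      ∫ ω, {w | PullsAt g tie t k a j w}.indicator 1 (fun s => W s ω) * mean k ∂P := by
  have hms := measurableSet_pullsAt g htie t k a j
  have hmeas : Measurable ({w | PullsAt g tie t k a j w}.indicator (1 : (Source → ℝ) → ℝ)) :=
    measurable_one.indicator hms
  have hind : IndepFun (fun ω => {w | PullsAt g tie t k a j w}.indicator (1 : (Source → ℝ) → ℝ)
      (fun s => W s ω)) (W (.reward k a j)) P := by
    refine indepFun_of_dependsOn (G := fun w => w (.reward k a j)) (S := {.reward k a j}ᶜ)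
      (T := {.reward k a j}) hW.measurable hW.indep hmeas (measurable_pi_apply _) ?_ ?_
      disjoint_compl_left
    · intro w w' h
      have : PullsAt g tie t k a j w ↔ PullsAt g tie t k a j w' :=
        ⟨pullsAt_congr hΔ fun r hr => (h r (by simpa using hr)).symm,
          pullsAt_congr hΔ fun r hr => h r (by simpa using hr)⟩
      by_cases hp : PullsAt g tie t k a j w
      · rw [Set.indicator_of_mem (show w ∈ {w | PullsAt g tie t k a j w} from hp),
          Set.indicator_of_mem (show w' ∈ {w | PullsAt g tie t k a j w} from this.1 hp)]
        rfl
      · rw [Set.indicator_of_notMem (show w ∉ {w | PullsAt g tie t k a j w} from hp),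
          Set.indicator_of_notMem (show w' ∉ {w | PullsAt g tie t k a j w} from mt this.2 hp)]
    · intro w w' h
      exact h _ rfl
  have hmW : Measurable fun ω s => W s ω := measurable_pi_iff.2 hW.measurable
  rw [hind.integral_fun_mul_eq_mul_integral (hmeas.comp hmW).aestronglyMeasurable
    (hW.measurable _).aestronglyMeasurable, hW.reward_mean, integral_mul_const]

-- Exactly one triple of type, arm and pull number occurs in round `t`. This turns a quantity with
-- random labels into a finite sum with deterministic ones, to which linearity of the integral
-- applies.
open Classical in
lemma sum_pullsAt {mean : ArmType → ℝ} (hΔ : mean .inferior < mean .optimal) (g : ℕ → ℝ)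
    (tie : TieRule) (t : ℕ) (w : Source → ℝ) (F : ArmType → ℕ → ℕ → ℝ) :
    F (drawnKind g w (played g tie w t)) (played g tie w t)
      ((run g tie w t).pulls (played g tie w t)) =
    ∑ k ∈ ({.optimal, .inferior} : Finset ArmType), ∑ a ∈ Finset.range (2 * t + 3),
      ∑ j ∈ Finset.range (t + 1), {w | PullsAt g tie t k a j w}.indicator 1 w * F k a j := by
  have ha := played_le g tie w hΔ t
  have hj := run_pulls_le g tie w t (played g tie w t)
  rw [Finset.sum_eq_single_of_mem (drawnKind g w (played g tie w t)),
    Finset.sum_eq_single_of_mem (played g tie w t),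
    Finset.sum_eq_single_of_mem ((run g tie w t).pulls (played g tie w t))]
  · simp [PullsAt]
  · simp; omega
  · intro j _ hne
    simp [PullsAt, hne.symm]
  · simp; omega
  · intro a _ hne
    refine Finset.sum_eq_zero fun j _ => ?_
    simp [PullsAt, hne.symm]
  · cases drawnKind g w (played g tie w t) <;> simp
  · intro k _ hne
    refine Finset.sum_eq_zero fun a _ => Finset.sum_eq_zero fun j _ => ?_
    rw [Set.indicator_of_notMem, zero_mul]
    rintro ⟨rfl, -, h⟩
    exact hne h.symm

section

variable {Ω : Type*} [MeasurableSpace Ω] {P : Measure Ω} [IsProbabilityMeasure P]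
  {mean : ArmType → ℝ} {W : Source → Ω → ℝ}

lemma measurable_sources (hW : IsPrimitives P mean W) : Measurable fun ω s => W s ω :=
  measurable_pi_iff.2 hW.measurable

lemma integrable_reward (hW : IsPrimitives P mean W) (k : ArmType) (a j : ℕ) :
    Integrable (W (.reward k a j)) P :=
  Integrable.of_mem_Icc 0 1 (hW.measurable _).aemeasurable (hW.reward_mem k a j)

lemma integrable_indicator_mul (hW : IsPrimitives P mean W) {A : Set (Source → ℝ)}
    (hA : MeasurableSet A) {Y : Ω → ℝ} (hY : Integrable Y P) :
    Integrable (fun ω => A.indicator 1 (fun s => W s ω) * Y ω) P := by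
  have : (fun ω => A.indicator 1 (fun s => W s ω) * Y ω) =
      ((fun ω s => W s ω) ⁻¹' A).indicator Y := by
    funext ω
    by_cases h : (fun s => W s ω) ∈ A
    · simp [h]
    · simp [h]
  rw [this]
  exact hY.indicator (measurable_sources hW hA)

lemma integrable_earned (hW : IsPrimitives P mean W) (hΔ : mean .inferior < mean .optimal)
    (g : ℕ → ℝ) {tie : TieRule}
    (htie : ∀ t, Measurable (fun p : (ℕ → ℕ × ℝ) × ℝ => tie t p.1 p.2)) (t : ℕ) :
    Integrable (fun ω => earned g tie t fun s => W s ω) P := by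
  have h : ∀ ω, earned g tie t (fun s => W s ω) = _ :=
    fun ω => sum_pullsAt hΔ g tie t (fun s => W s ω) fun k a j => W (Source.reward k a j) ω
  simp only [h]
  refine integrable_finsetSum _ fun k _ => integrable_finsetSum _ fun a _ =>
    integrable_finsetSum _ fun j _ => ?_
  exact integrable_indicator_mul hW (measurableSet_pullsAt g htie t k a j)
    (integrable_reward hW k a j)

lemma integral_earned (hW : IsPrimitives P mean W) (hΔ : mean .inferior < mean .optimal)
    (g : ℕ → ℝ) {tie : TieRule}
    (htie : ∀ t, Measurable (fun p : (ℕ → ℕ × ℝ) × ℝ => tie t p.1 p.2)) (t : ℕ) :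
    ∫ ω, earned g tie t (fun s => W s ω) ∂P =
      ∫ ω, mean (drawnKind g (fun s => W s ω) (played g tie (fun s => W s ω) t)) ∂P := by
  have h2 : ∀ ω, mean (drawnKind g (fun s => W s ω) (played g tie (fun s => W s ω) t)) = _ :=
    fun ω => sum_pullsAt hΔ g tie t (fun s => W s ω) fun k _ _ => mean k
  have h1 : ∀ ω, earned g tie t (fun s => W s ω) = _ :=
    fun ω => sum_pullsAt hΔ g tie t (fun s => W s ω) fun k a j => W (Source.reward k a j) ω
  simp only [h1, h2]
  have i1 : ∀ k a j, Integrable (fun ω => {w | PullsAt g tie t k a j w}.indicator 1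
      (fun s => W s ω) * W (.reward k a j) ω) P := fun k a j =>
    integrable_indicator_mul hW (measurableSet_pullsAt g htie t k a j) (integrable_reward hW k a j)
  have i2 : ∀ k a j, Integrable (fun ω => {w | PullsAt g tie t k a j w}.indicator 1
      (fun s => W s ω) * mean k) P := fun k a j =>
    integrable_indicator_mul hW (measurableSet_pullsAt g htie t k a j) (integrable_const _)
  rw [integral_finsetSum _ fun k _ => integrable_finsetSum _ fun a _ =>
      integrable_finsetSum _ fun j _ => i1 k a j,
    integral_finsetSum _ fun k _ => integrable_finsetSum _ fun a _ =>
      integrable_finsetSum _ fun j _ => i2 k a j]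
  refine Finset.sum_congr rfl fun k _ => ?_
  rw [integral_finsetSum _ fun a _ => integrable_finsetSum _ fun j _ => i1 k a j,
    integral_finsetSum _ fun a _ => integrable_finsetSum _ fun j _ => i2 k a j]
  refine Finset.sum_congr rfl fun a _ => ?_
  rw [integral_finsetSum _ fun j _ => i1 k a j, integral_finsetSum _ fun j _ => i2 k a j]
  exact Finset.sum_congr rfl fun j _ => integral_indicator_mul_reward hW hΔ g htie t k a j

lemma regret_eq (hΔ : mean .inferior < mean .optimal) (g : ℕ → ℝ) (tie : TieRule) (w : Source → ℝ)
    (n : ℕ) : regret mean g tie w n =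
      ∑ t ∈ Finset.range n, (mean .optimal - earned g tie t w) :=
  Finset.sum_congr rfl fun t ht => by rw [run_obs hΔ (Finset.mem_range.1 ht)]

lemma integrable_regret (hW : IsPrimitives P mean W) (hΔ : mean .inferior < mean .optimal)
    (g : ℕ → ℝ) {tie : TieRule}
    (htie : ∀ t, Measurable (fun p : (ℕ → ℕ × ℝ) × ℝ => tie t p.1 p.2)) (n : ℕ) :
    Integrable (fun ω => regret mean g tie (fun s => W s ω) n) P := by
  simp only [regret_eq hΔ]
  exact integrable_finsetSum _ fun t _ => (integrable_const _).sub (integrable_earned hW hΔ g htie t)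

open Classical in
/-- The expected regret is `Δ` times the expected number of plays of inferior arms. -/
lemma integral_regret (hW : IsPrimitives P mean W) (hΔ : mean .inferior < mean .optimal)
    (g : ℕ → ℝ) {tie : TieRule}
    (htie : ∀ t, Measurable (fun p : (ℕ → ℕ × ℝ) × ℝ => tie t p.1 p.2)) (n : ℕ) :
    ∫ ω, regret mean g tie (fun s => W s ω) n ∂P = (mean .optimal - mean .inferior) *
      ∫ ω, ∑ t ∈ Finset.range n, (if drawnKind g (fun s => W s ω)
        (played g tie (fun s => W s ω) t) = .inferior then (1 : ℝ) else 0) ∂P := by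
  have hk : ∀ t, Measurable fun ω => drawnKind g (fun s => W s ω)
      (played g tie (fun s => W s ω) t) := fun t =>
    (measurable_drawnKind_played g htie t).comp (measurable_sources hW)
  have hmean : ∀ t, Integrable (fun ω => mean (drawnKind g (fun s => W s ω)
      (played g tie (fun s => W s ω) t))) P := fun t => by
    refine Integrable.of_mem_Icc (mean .inferior) (mean .optimal)
      (Measurable.of_discrete.comp (hk t)).aemeasurable (ae_of_all _ fun ω => ?_)
    cases drawnKind g (fun s => W s ω) (played g tie (fun s => W s ω) t) <;> simp [hΔ.le]
  have he : ∀ t, Integrable (fun ω => mean .optimal - earned g tie t fun s => W s ω) P :=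
    fun t => (integrable_const _).sub (integrable_earned hW hΔ g htie t)
  have hk' : ∀ t, Integrable (fun ω => mean .optimal - mean (drawnKind g (fun s => W s ω)
      (played g tie (fun s => W s ω) t))) P := fun t => (integrable_const _).sub (hmean t)
  simp only [regret_eq hΔ]
  rw [integral_finsetSum _ fun t _ => he t, ← integral_const_mul]
  simp only [Finset.mul_sum]
  have hI : ∀ t ω, (mean .optimal - mean .inferior) * (if drawnKind g (fun s => W s ω)
        (played g tie (fun s => W s ω) t) = .inferior then (1 : ℝ) else 0) =
      mean .optimal - mean (drawnKind g (fun s => W s ω)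
        (played g tie (fun s => W s ω) t)) := fun t ω => by
    cases drawnKind g (fun s => W s ω) (played g tie (fun s => W s ω) t) <;> simp
  simp only [hI]
  rw [integral_finsetSum _ fun t _ => hk' t]
  refine Finset.sum_congr rfl fun t _ => ?_
  rw [integral_sub (integrable_const _) (integrable_earned hW hΔ g htie t),
    integral_sub (integrable_const _) (hmean t), integral_earned hW hΔ g htie t]

end

section

variable {Ω : Type*} [MeasurableSpace Ω] {P : Measure Ω} [IsProbabilityMeasure P]
  {mean : ArmType → ℝ} {W : Source → Ω → ℝ}

/-! ### Tail bounds -/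

lemma subgaussian_reward (hW : IsPrimitives P mean W) (k : ArmType) (a j : ℕ) :
    HasSubgaussianMGF (fun ω => W (.reward k a j) ω - mean k) (1 / 4) P := by
  have h := hasSubgaussianMGF_of_mem_Icc (hW.measurable (.reward k a j)).aemeasurable
    (hW.reward_mem k a j)
  rw [hW.reward_mean] at h
  convert h using 1
  rw [sub_zero, nnnorm_one]
  norm_num

lemma iIndepFun_reward (hW : IsPrimitives P mean W) (k : ArmType) (a : ℕ) :
    iIndepFun (fun j ω => W (.reward k a j) ω - mean k) P :=
  (hW.indep.precomp (g := fun j => Source.reward k a j) (fun i j h => by simpa using h)).comp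
    (fun _ x => x - mean k) fun _ => measurable_id.sub_const _

lemma exp_bound_eq (n : ℕ) (ε : ℝ) :
    Real.exp (-ε ^ 2 / (2 * n * ((1 / 4 : NNReal) : ℝ))) = Real.exp (-2 * ε ^ 2 / n) := by
  congr 1
  push_cast
  -- For `n = 0` both quotients are `0` by the convention for division.
  rcases eq_or_ne (n : ℝ) 0 with h | h
  · simp [h]
  · field_simp
    norm_num

lemma upper_tail (hW : IsPrimitives P mean W) (k : ArmType) (a n : ℕ) {ε : ℝ} (hε : 0 ≤ ε) :
    P.real {ω | ε ≤ ∑ j ∈ Finset.range n, W (.reward k a j) ω - n * mean k} ≤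
      Real.exp (-2 * ε ^ 2 / n) := by
  have h := HasSubgaussianMGF.measure_sum_range_ge_le_of_iIndepFun (iIndepFun_reward hW k a)
    (n := n) (fun j _ => subgaussian_reward hW k a j) hε
  simp only [Finset.sum_sub_distrib, Finset.sum_const, Finset.card_range, nsmul_eq_mul] at h
  rwa [exp_bound_eq] at h

lemma lower_tail (hW : IsPrimitives P mean W) (k : ArmType) (a n : ℕ) {ε : ℝ} (hε : 0 ≤ ε) :
    P.real {ω | ∑ j ∈ Finset.range n, W (.reward k a j) ω - n * mean k ≤ -ε} ≤
      Real.exp (-2 * ε ^ 2 / n) := by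
  have h := HasSubgaussianMGF.measure_sum_range_ge_le_of_iIndepFun
    ((iIndepFun_reward hW k a).comp (fun _ x => -x) fun _ => measurable_neg)
    (n := n) (fun j _ => (subgaussian_reward hW k a j).neg) hε
  simp only [Function.comp_apply, Finset.sum_neg_distrib, Finset.sum_sub_distrib, Finset.sum_const,
    Finset.card_range, nsmul_eq_mul, le_neg (a := ε)] at h
  rwa [exp_bound_eq] at h

lemma abs_tail (hW : IsPrimitives P mean W) (k : ArmType) (a n : ℕ) {ε : ℝ} (hε : 0 ≤ ε) :
    P.real {ω | ε ≤ |∑ j ∈ Finset.range n, W (.reward k a j) ω - n * mean k|} ≤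
      2 * Real.exp (-2 * ε ^ 2 / n) := by
  have hsub : {ω | ε ≤ |∑ j ∈ Finset.range n, W (.reward k a j) ω - n * mean k|} ⊆
      {ω | ε ≤ ∑ j ∈ Finset.range n, W (.reward k a j) ω - n * mean k} ∪
      {ω | ∑ j ∈ Finset.range n, W (.reward k a j) ω - n * mean k ≤ -ε} := by
    intro ω hω
    rcases le_abs.1 (show ε ≤ |_| from hω) with h | h
    · exact .inl h
    · exact .inr (by have := h; change _ ≤ -ε; linarith)
  linarith [measureReal_mono (μ := P) hsub, measureReal_union_le (μ := P)
    {ω | ε ≤ ∑ j ∈ Finset.range n, W (.reward k a j) ω - n * mean k}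
    {ω | ∑ j ∈ Finset.range n, W (.reward k a j) ω - n * mean k ≤ -ε},
    upper_tail hW k a n hε, lower_tail hW k a n hε]

lemma noise_tail (hW : IsPrimitives P mean W) (e : ℕ) {ε : ℝ} (hε : 0 ≤ ε) :
    P.real {ω | ε ≤ |W (.noise e) ω|} ≤ 2 * Real.exp (-ε ^ 2 / 2) := by
  have hs : HasSubgaussianMGF (W (.noise e)) 1 P := by
    constructor
    · intro t
      have : Integrable (fun x => Real.exp (t * x)) (P.map (W (.noise e))) := by
        rw [hW.noise_law]; exact integrable_exp_mul_gaussianReal t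
      exact this.comp_measurable (hW.measurable _)
    · intro t
      rw [mgf_gaussianReal (hW.noise_law e)]
      simp
  have hsub : {ω | ε ≤ |W (.noise e) ω|} ⊆
      {ω | ε ≤ W (.noise e) ω} ∪ {ω | ε ≤ (-W (.noise e)) ω} := by
    intro ω hω
    exact le_abs.1 (show ε ≤ |_| from hω)
  have h1 := hs.measure_ge_le hε
  have h2 := hs.neg.measure_ge_le hε
  simp only [NNReal.coe_one, mul_one] at h1 h2
  linarith [measureReal_mono (μ := P) hsub, measureReal_union_le (μ := P)
    {ω | ε ≤ W (.noise e) ω} {ω | ε ≤ (-W (.noise e)) ω}]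

lemma exp_neg_nat_mul_log {t : ℕ} (ht : 1 ≤ t) (n : ℕ) :
    Real.exp (-(n * Real.log t)) = 1 / (t : ℝ) ^ n := by
  have : (0 : ℝ) < t := by exact_mod_cast ht
  rw [Real.exp_neg, Real.exp_nat_mul, Real.exp_log this, one_div]

/-- Hoeffding's inequality gives the exponent `4 * (7/8) ^ 2 = 49/16`, just above `3`; this is the
reason for the fraction `7/8`. -/
lemma deviation_tail (hW : IsPrimitives P mean W) (k : ArmType) (a : ℕ) {s t : ℕ} (hs : 1 ≤ s)
    (ht : 1 ≤ t) :
    P.real {ω | 7 / 8 * √(2 * s * Real.log t) ≤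
      |∑ j ∈ Finset.range s, W (.reward k a j) ω - s * mean k|} ≤ 2 * (1 / (t : ℝ) ^ 3) := by
  refine (abs_tail hW k a s (by positivity)).trans ?_
  have hlog := Real.log_natCast_nonneg t
  have hs' : (0 : ℝ) < s := by exact_mod_cast hs
  rw [← exp_neg_nat_mul_log ht 3, mul_pow, Real.sq_sqrt (by positivity)]
  gcongr
  rw [div_le_iff₀ hs']
  push_cast
  nlinarith [mul_nonneg hs'.le hlog]

/-- Union bound over two types, two arms and `t` sample counts. Including both types makes the event
independent of the marks. -/
lemma prob_deviates_le (hW : IsPrimitives P mean W) (e t : ℕ) :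
    P.real {ω | Deviates mean (fun s => W s ω) e t} ≤ 8 * (1 / (t : ℝ) ^ 2) := by
  rcases Nat.eq_zero_or_pos t with rfl | ht
  · have : {ω | Deviates mean (fun s => W s ω) e 0} = ∅ := by
      ext ω
      simp only [Deviates, Set.mem_ofPred_eq, Set.mem_empty_iff_false, iff_false]
      rintro ⟨_, _, _, s, h1, h2, _⟩
      omega
    rw [this]
    simp
  have hsub : {ω | Deviates mean (fun s => W s ω) e t} ⊆
      ⋃ p ∈ ({.optimal, .inferior} : Finset ArmType) ×ˢ Finset.range 2 ×ˢ Finset.Icc 1 t,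
        {ω | 7 / 8 * √(2 * p.2.2 * Real.log t) ≤ |∑ j ∈ Finset.range p.2.2,
          W (.reward p.1 (2 * e + p.2.1) j) ω - p.2.2 * mean p.1|} := by
    rintro ω ⟨k, i, hi, s, h1, h2, h⟩
    refine Set.mem_iUnion₂.2 ⟨(k, i, s), ?_, h⟩
    cases k <;> simp [hi, h1, h2]
  refine (measureReal_mono hsub (measure_ne_top _ _)).trans ((measureReal_biUnion_finset_le _ _).trans ?_)
  have hb : ∀ p ∈ ({.optimal, .inferior} : Finset ArmType) ×ˢ Finset.range 2 ×ˢ Finset.Icc 1 t,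
      P.real {ω | 7 / 8 * √(2 * p.2.2 * Real.log t) ≤ |∑ j ∈ Finset.range p.2.2,
          W (.reward p.1 (2 * e + p.2.1) j) ω - p.2.2 * mean p.1|} ≤ 2 * (1 / (t : ℝ) ^ 3) := by
    intro p hp
    simp only [Finset.mem_product, Finset.mem_Icc] at hp
    exact deviation_tail hW _ _ hp.2.2.1 ht
  refine (Finset.sum_le_card_nsmul _ _ _ hb).trans ?_
  have ht' : (0 : ℝ) < t := by exact_mod_cast ht
  rw [Finset.card_product, Finset.card_product, Finset.card_pair (by simp), Finset.card_range,
    Nat.card_Icc, nsmul_eq_mul]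
  push_cast
  apply le_of_eq
  field_simp
  norm_num

/-- With equal means the threshold `4 * r` can be reached only if the noise reaches `2 * r` or one
of the two centred sums reaches `r`; each of the three events has probability at most `2 / m ^ 2`.
-/
lemma prob_not_rejects_le (hW : IsPrimitives P mean W) (e : ℕ) {m : ℕ} (hm : 1 ≤ m) :
    P.real {ω | ¬ Rejects (fun s => W s ω) .inferior .inferior e m} ≤ 6 * (1 / (m : ℝ) ^ 2) := by
  have hm' : (1 : ℝ) ≤ m := by exact_mod_cast hm
  have hlog := Real.log_natCast_nonneg m
  set r := √(m * Real.log m) with hr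
  have hr0 : 0 ≤ r := Real.sqrt_nonneg _
  have hr2 : r ^ 2 = m * Real.log m := Real.sq_sqrt (by positivity)
  set A := {ω | 2 * r ≤ |W (.noise e) ω|}
  set B := fun a : ℕ => {ω | r ≤ |∑ j ∈ Finset.range m, W (.reward .inferior a j) ω -
    m * mean .inferior|}
  have hsub : {ω | ¬ Rejects (fun s => W s ω) .inferior .inferior e m} ⊆
      A ∪ (B (2 * e) ∪ B (2 * e + 1)) := by
    intro ω hω
    by_contra hcon
    simp only [A, B, Set.mem_union, Set.mem_ofPred_eq, not_or, not_le] at hcon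
    obtain ⟨h1, h2, h3⟩ := hcon
    refine hω ?_
    unfold Rejects
    rw [← hr, Finset.sum_sub_distrib]
    rw [abs_lt] at *
    constructor <;> linarith
  have hA : P.real A ≤ 2 * (1 / (m : ℝ) ^ 2) := by
    refine (noise_tail hW e (by positivity)).trans ?_
    rw [← exp_neg_nat_mul_log hm 2, mul_pow, hr2]
    gcongr
    push_cast
    nlinarith
  have hB : ∀ a, P.real (B a) ≤ 2 * (1 / (m : ℝ) ^ 2) := by
    intro a
    refine (abs_tail hW .inferior a m hr0).trans ?_
    rw [← exp_neg_nat_mul_log hm 2, hr2]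
    rw [show -2 * (m * Real.log m) / m = -((2 : ℕ) * Real.log m) by push_cast; field_simp]
  linarith [measureReal_mono (μ := P) hsub, measureReal_union_le (μ := P) A (B (2 * e) ∪ B (2 * e + 1)),
    measureReal_union_le (μ := P) (B (2 * e)) (B (2 * e + 1)), hB (2 * e), hB (2 * e + 1)]

/-! ### The survival of an epoch with arms of different types -/

lemma mean_mem (hW : IsPrimitives P mean W) (k : ArmType) : mean k ∈ Set.Icc (0 : ℝ) 1 := by
  rw [← hW.reward_mean k 0 0]
  constructor
  · exact integral_nonneg_of_ae ((hW.reward_mem k 0 0).mono fun ω h => h.1)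
  · have := integral_mono_ae (integrable_reward hW k 0 0) (integrable_const (1 : ℝ))
      ((hW.reward_mem k 0 0).mono fun ω h => h.2)
    simpa using this

lemma one_le_T₀ {Δ : ℝ} (h0 : 0 < Δ) (h1 : Δ ≤ 1) : 1 ≤ T₀ Δ := by
  refine Nat.one_le_iff_ne_zero.2 (Nat.ceil_pos.2 ?_).ne'
  have : 1 < 64 / Δ ^ 2 := by
    rw [lt_div_iff₀ (by positivity)]
    nlinarith
  have := Real.log_pos this
  positivity

/-- Since `log x / x` decreases beyond `e`, the point `x = a * l ^ 2` suffices. There `log x = l + 2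
* log l ≤ 3 * l - 2 ≤ l ^ 2`, the last step because `l ≥ 2`. -/
lemma log_le_of_T₀_le {Δ : ℝ} (h0 : 0 < Δ) (h1 : Δ ≤ 1) {m : ℕ} (hm : T₀ Δ ≤ m) :
    Real.log m ≤ Δ ^ 2 / 64 * m := by
  set a := 64 / Δ ^ 2 with ha
  have ha64 : 64 ≤ a := by
    rw [ha, le_div_iff₀ (by positivity)]
    nlinarith
  have ha0 : 0 < a := by linarith
  set l := Real.log a with hl
  have hl2 : 2 ≤ l := by
    have h2 : Real.log 64 = 6 * Real.log 2 := by
      rw [show (64 : ℝ) = 2 ^ 6 by norm_num, Real.log_pow]; norm_num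
    have := Real.log_le_log (by norm_num) ha64
    linarith [Real.log_two_gt_d9]
  have hx : a * l ^ 2 ≤ m := (Nat.le_ceil _).trans (by exact_mod_cast hm)
  have hx0 : 0 < a * l ^ 2 := by positivity
  have hm0 : (0 : ℝ) < m := hx0.trans_le hx
  have hex : Real.exp 1 ≤ a * l ^ 2 := by
    have := Real.exp_one_lt_d9
    nlinarith
  have hmono := Real.log_div_self_antitoneOn hex (hex.trans hx) hx
  have hlx : Real.log (a * l ^ 2) ≤ l ^ 2 := by
    rw [Real.log_mul ha0.ne' (by positivity), Real.log_pow]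
    have := Real.log_le_sub_one_of_pos (show 0 < l by linarith)
    push_cast
    nlinarith
  have h3 : Real.log m / m ≤ 1 / a := by
    refine hmono.trans ?_
    rw [div_le_div_iff₀ hx0 ha0]
    nlinarith
  rw [div_le_iff₀ hm0] at h3
  calc Real.log m ≤ 1 / a * m := h3
    _ = Δ ^ 2 / 64 * m := by rw [ha]; field_simp

lemma four_sqrt_le {Δ : ℝ} (h0 : 0 < Δ) (h1 : Δ ≤ 1) {m : ℕ} (hm : T₀ Δ ≤ m) :
    4 * √(m * Real.log m) ≤ Δ * m / 2 := by
  have h := log_le_of_T₀_le h0 h1 hm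
  have : √(m * Real.log m) ≤ Δ * m / 8 := by
    refine Real.sqrt_le_iff.2 ⟨by positivity, ?_⟩
    calc (m : ℝ) * Real.log m ≤ m * (Δ ^ 2 / 64 * m) := by gcongr
      _ = (Δ * m / 8) ^ 2 := by ring
  linarith

/-- The difference of the accumulated rewards of an optimal arm `a` and an inferior arm `b`. -/
def lead (w : Source → ℝ) (a b m : ℕ) : ℝ :=
  ∑ j ∈ Finset.range m, (w (.reward .optimal a j) - w (.reward .inferior b j))

/-- The lead has mean `Δ * m` and the threshold is at most half of it, so one of the two sums is off
by `Δ * m / 4`. Hoeffding's exponent `Δ ^ 2 * m / 8` is at least `8 * log m` by the choice of `T₀`.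
-/
lemma prob_lead_lt_le (hW : IsPrimitives P mean W) (hΔ : mean .inferior < mean .optimal)
    (a b : ℕ) {m : ℕ} (hm : T₀ (mean .optimal - mean .inferior) ≤ m) (hm1 : 1 ≤ m) :
    P.real {ω | lead (fun s => W s ω) a b m < 4 * √(m * Real.log m)} ≤ 2 * (1 / (m : ℝ) ^ 8) := by
  set Δ := mean .optimal - mean .inferior with hΔdef
  have h0 : 0 < Δ := sub_pos.2 hΔ
  have h1 : Δ ≤ 1 := by
    have := (mean_mem hW .optimal).2
    have := (mean_mem hW .inferior).1
    linarith
  have hm' : (0 : ℝ) < m := by exact_mod_cast hm1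
  have hsq := four_sqrt_le h0 h1 hm
  set A := {ω | ∑ j ∈ Finset.range m, W (.reward .optimal a j) ω - m * mean .optimal ≤
    -(Δ * m / 4)}
  set B := {ω | Δ * m / 4 ≤ ∑ j ∈ Finset.range m, W (.reward .inferior b j) ω -
    m * mean .inferior}
  have hsub : {ω | lead (fun s => W s ω) a b m < 4 * √(m * Real.log m)} ⊆ A ∪ B := by
    intro ω hω
    by_contra hcon
    simp only [A, B, Set.mem_union, Set.mem_ofPred_eq, not_or, not_le] at hcon
    have hω' : lead (fun s => W s ω) a b m < 4 * √(m * Real.log m) := hω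
    rw [lead, Finset.sum_sub_distrib] at hω'
    have : (m : ℝ) * mean .optimal - m * mean .inferior = Δ * m := by rw [hΔdef]; ring
    linarith [hcon.1, hcon.2]
  have hexp : Real.exp (-2 * (Δ * m / 4) ^ 2 / m) ≤ 1 / (m : ℝ) ^ 8 := by
    rw [← exp_neg_nat_mul_log hm1 8]
    gcongr
    have := log_le_of_T₀_le h0 h1 hm
    rw [div_le_iff₀ hm']
    push_cast
    nlinarith
  linarith [measureReal_mono (μ := P) hsub, measureReal_union_le (μ := P) A B,
    lower_tail hW .optimal a m (ε := Δ * m / 4) (by positivity),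
    upper_tail hW .inferior b m (ε := Δ * m / 4) (by positivity)]

lemma sum_telescope_le (n : ℕ) :
    ∑ i ∈ Finset.range n, 1 / (((i : ℝ) + 2) * (i + 3)) ≤ 1 / 2 := by
  have : ∀ n : ℕ, ∑ i ∈ Finset.range n, 1 / (((i : ℝ) + 2) * (i + 3)) = 1 / 2 - 1 / (n + 2) := by
    intro n
    induction n with
    | zero => simp
    | succ n ih =>
      rw [Finset.sum_range_succ, ih]
      push_cast
      field_simp
      ring
  rw [this]
  have : (0 : ℝ) ≤ 1 / (n + 2) := by positivity
  linarith

lemma prob_lead_le (hW : IsPrimitives P mean W) (hΔ : mean .inferior < mean .optimal) (a b : ℕ) :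
    P.real {ω | ∃ m, T₀ (mean .optimal - mean .inferior) < m ∧
      lead (fun s => W s ω) a b m < 4 * √(m * Real.log m)} ≤ 1 / 2 := by
  set T := T₀ (mean .optimal - mean .inferior) with hT
  have hT1 : 1 ≤ T := by
    refine one_le_T₀ (sub_pos.2 hΔ) ?_
    have := (mean_mem hW .optimal).2
    have := (mean_mem hW .inferior).1
    linarith
  set A : ℕ → Set Ω := fun i => {ω | lead (fun s => W s ω) a b (T + 1 + i) <
    4 * √((T + 1 + i : ℕ) * Real.log (T + 1 + i : ℕ))}
  have hsub : {ω | ∃ m, T < m ∧ lead (fun s => W s ω) a b m < 4 * √(m * Real.log m)} ⊆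
      ⋃ i, A i := by
    rintro ω ⟨m, hm, h⟩
    refine Set.mem_iUnion.2 ⟨m - (T + 1), ?_⟩
    change lead _ _ _ (T + 1 + (m - (T + 1))) <
      4 * √((T + 1 + (m - (T + 1)) : ℕ) * Real.log (T + 1 + (m - (T + 1)) : ℕ))
    rw [show T + 1 + (m - (T + 1)) = m by omega]
    exact h
  -- The eighth power leaves ample room for a telescoping majorant with sum at most `1/2`; the shift
  -- by `2` uses `T ≥ 1`.
  have hA : ∀ i, P (A i) ≤ ENNReal.ofReal (1 / (((i : ℝ) + 2) * (i + 3))) := by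
    intro i
    rw [← ofReal_measureReal]
    refine ENNReal.ofReal_le_ofReal ((prob_lead_lt_le hW hΔ a b (by omega) (by omega)).trans ?_)
    have hi : (i : ℝ) + 2 ≤ (T + 1 + i : ℕ) := by
      have : i + 2 ≤ T + 1 + i := by omega
      exact_mod_cast this
    set x : ℝ := ((T + 1 + i : ℕ) : ℝ)
    have hx2 : 2 ≤ x := by have : (0 : ℝ) ≤ i := by positivity
                           linarith
    rw [mul_one_div, div_le_div_iff₀ (by positivity) (by positivity), one_mul]
    have h6 : (2 : ℝ) ^ 6 ≤ x ^ 6 := by gcongr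
    have h2 : ((i : ℝ) + 2) * (i + 3) ≤ x * (x + 1) :=
      mul_le_mul hi (by linarith) (by positivity) (by positivity)
    have h8 : x ^ 8 = x ^ 6 * x ^ 2 := by ring
    rw [h8]
    nlinarith [sq_nonneg x, mul_le_mul_of_nonneg_right h6 (sq_nonneg x)]
  have hle : P (⋃ i, A i) ≤ ENNReal.ofReal (1 / 2) := by
    refine (measure_iUnion_le _).trans ((ENNReal.tsum_le_tsum hA).trans ?_)
    refine ENNReal.tsum_le_of_sum_range_le fun n => ?_
    rw [← ENNReal.ofReal_sum_of_nonneg fun i _ => by positivity]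
    exact ENNReal.ofReal_le_ofReal (sum_telescope_le n)
  exact ENNReal.toReal_le_of_le_ofReal (by norm_num) ((measure_mono hsub).trans hle)

lemma gaussianReal_Ici (v : ℝ) : (gaussianReal 0 1).real (Set.Ici v) = gaussianTail v := by
  rw [measureReal_def, gaussianReal_apply_eq_integral 0 one_ne_zero, integral_Ici_eq_integral_Ioi,
    ENNReal.toReal_ofReal (integral_nonneg fun _ => gaussianPDFReal_nonneg _ _ _), gaussianTail,
    ← integral_const_mul]
  simp [gaussianPDFReal]

lemma gaussianTail_pos (v : ℝ) : 0 < gaussianTail v := by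
  rw [← gaussianReal_Ici, measureReal_def]
  refine ENNReal.toReal_pos (fun h => ?_) (measure_ne_top _ _)
  have : volume (Set.Ici v) = 0 := gaussianReal_absolutelyContinuous' 0 one_ne_zero h
  simp at this

lemma β_pos (Δ : ℝ) : 0 < β Δ := half_pos (gaussianTail_pos _)

lemma β_le (Δ : ℝ) : β Δ ≤ 1 / 2 := by
  have : gaussianTail (f (T₀ Δ)) ≤ 1 := by
    rw [← gaussianReal_Ici]; exact measureReal_le_one
  unfold β
  linarith

lemma prob_noise_ge (hW : IsPrimitives P mean W) (e : ℕ) (v : ℝ) :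
    P.real {ω | v ≤ W (.noise e) ω} = gaussianTail v := by
  rw [← gaussianReal_Ici, ← hW.noise_law e, map_measureReal_apply (hW.measurable _)
    measurableSet_Ici]
  rfl

lemma prob_neg_noise_ge (hW : IsPrimitives P mean W) (e : ℕ) (v : ℝ) :
    P.real {ω | v ≤ -W (.noise e) ω} = gaussianTail v := by
  have h : gaussianReal 0 1 = P.map (fun ω => -W (.noise e) ω) := by
    have h1 := gaussianReal_map_neg (μ := 0) (v := 1)
    rw [neg_zero, ← hW.noise_law e, Measure.map_map measurable_neg (hW.measurable _)] at h1
    rw [← hW.noise_law e]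
    exact h1.symm
  rw [← gaussianReal_Ici, h, map_measureReal_apply (f := fun ω => -W (.noise e) ω)
    (hW.measurable _).neg measurableSet_Ici]
  rfl

/-- Events are treated as random variables with values in `Prop`, and independence is evaluated at
`{True}`. -/
lemma prob_and_eq_mul (hW : IsPrimitives P mean W) {A B : (Source → ℝ) → Prop} {S T : Set Source}
    (hA : MeasurableSet {w | A w}) (hB : MeasurableSet {w | B w}) (hAS : DependsOn A S)
    (hBT : DependsOn B T) (hST : Disjoint S T) :
    P.real {ω | A (fun s => W s ω) ∧ B (fun s => W s ω)} =
      P.real {ω | A (fun s => W s ω)} * P.real {ω | B (fun s => W s ω)} := by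
  have h := (indepFun_of_dependsOn hW.measurable hW.indep (measurableSet_setOfPred.1 hA)
    (measurableSet_setOfPred.1 hB) hAS hBT hST).measure_inter_preimage_eq_mul {True} {True}
    (measurableSet_singleton _) (measurableSet_singleton _)
  have e1 : ∀ C : (Source → ℝ) → Prop, (fun ω => C fun s => W s ω) ⁻¹' {True} =
      {ω | C fun s => W s ω} := fun C => by ext ω; simp
  rw [e1, e1] at h
  rw [measureReal_def, measureReal_def, measureReal_def, ← ENNReal.toReal_mul, ← h]
  rfl

lemma measurable_lead (a b m : ℕ) : Measurable fun w => lead w a b m :=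
  Finset.measurable_sum _ fun _ _ => (measurable_pi_apply _).sub (measurable_pi_apply _)

/-- If the noise, with the sign `σ`, is large and the optimal arm `a` stays sufficiently ahead of the
inferior arm `b`, the test never rejects. -/
lemma prob_survive_ge (hW : IsPrimitives P mean W) (hΔ : mean .inferior < mean .optimal)
    (a b e : ℕ) {σ : ℝ} (hσ : ∀ v, P.real {ω | v ≤ σ * W (.noise e) ω} = gaussianTail v) :
    β (mean .optimal - mean .inferior) ≤ P.real {ω | ∀ m : ℕ,
      4 * √(m * Real.log m) ≤ |σ * W (.noise e) ω + lead (fun s => W s ω) a b m|} := by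
  set Δ := mean .optimal - mean .inferior with hΔdef
  set A : (Source → ℝ) → Prop := fun w => f (T₀ Δ) ≤ σ * w (.noise e) with hA
  set B : (Source → ℝ) → Prop := fun w => ∃ m, T₀ Δ < m ∧
      lead w a b m < 4 * √(m * Real.log m) with hB
  have hAm : MeasurableSet {w | A w} :=
    measurableSet_le measurable_const ((measurable_pi_apply _).const_mul _)
  have hBm : MeasurableSet {w | B w} := by
    simp only [hB, Set.ofPred_exists]
    exact MeasurableSet.iUnion fun m => (MeasurableSet.const _).inter
      (measurableSet_lt (measurable_lead a b m) measurable_const)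
  have hmul := prob_and_eq_mul hW (B := fun w => ¬ B w) (S := {.noise e}) (T := {.noise e}ᶜ) hAm
    hBm.compl
    (fun w w' h => by simp only [hA, h (.noise e) rfl])
    (fun w w' h => by
      have : ∀ m, lead w a b m = lead w' a b m := fun m => Finset.sum_congr rfl fun j _ => by
        rw [h (.reward _ _ _) (by simp), h (.reward _ _ _) (by simp)]
      simp only [hB, this])
    disjoint_compl_right
  have hBc : 1 / 2 ≤ P.real {ω | ¬ B (fun s => W s ω)} := by
    have h1 := prob_lead_le hW hΔ a b
    have h2 := probReal_compl_eq_one_sub (μ := P) (measurable_sources hW hBm)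
    have h3 : ((fun ω s => W s ω) ⁻¹' {w | B w})ᶜ = {ω | ¬ B (fun s => W s ω)} := rfl
    have h4 : ((fun ω s => W s ω) ⁻¹' {w | B w}) = {ω | B (fun s => W s ω)} := rfl
    rw [h3, h4] at h2
    rw [h2]
    linarith
  have hAB : β Δ ≤ P.real {ω | A (fun s => W s ω) ∧ ¬ B (fun s => W s ω)} := by
    rw [hmul, hσ, β]
    have := gaussianTail_pos (f (T₀ Δ))
    nlinarith
  refine hAB.trans (ENNReal.toReal_mono (measure_ne_top _ _) (measure_mono_ae ?_))
  have hae : ∀ᵐ ω ∂P, ∀ k a j, W (.reward k a j) ω ∈ Set.Icc (0 : ℝ) 1 := by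
    simp only [ae_all_iff]
    exact hW.reward_mem
  filter_upwards [hae] with ω hω hAB m
  obtain ⟨h1, h2⟩ := hAB
  simp only [hA] at h1
  refine le_trans ?_ (le_abs_self _)
  have hnn : 0 ≤ √(T₀ Δ * Real.log (T₀ Δ)) := Real.sqrt_nonneg _
  -- Beyond `T₀` the lead alone exceeds the threshold and the noise is nonnegative. Up to `T₀` the
  -- lead is at least `-m ≥ -T₀`, and the noise, at least `f T₀`, makes up for this and for the
  -- threshold, which increases with `m`.
  rcases Nat.lt_or_ge (T₀ Δ) m with hm | hm
  · have h3 : 4 * √(m * Real.log m) ≤ lead (fun s => W s ω) a b m := by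
      by_contra hcon
      exact h2 ⟨m, hm, not_le.1 hcon⟩
    have : 0 ≤ f (T₀ Δ) := by unfold f; positivity
    linarith
  · have h3 : -(m : ℝ) ≤ lead (fun s => W s ω) a b m := by
      have : ∑ j ∈ Finset.range m, (-1 : ℝ) ≤ lead (fun s => W s ω) a b m :=
        Finset.sum_le_sum fun j _ => by
          have := (hω .optimal a j).1
          have := (hω .inferior b j).2
          linarith
      simpa using this
    have h4 : √(m * Real.log m) ≤ √(T₀ Δ * Real.log (T₀ Δ)) := by
      rcases Nat.eq_zero_or_pos m with rfl | hm0
      · rwa [Nat.cast_zero, zero_mul, Real.sqrt_zero]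
      · have : (0 : ℝ) < m := by exact_mod_cast hm0
        have := Real.log_natCast_nonneg m
        gcongr
    have h5 : (m : ℝ) ≤ T₀ Δ := by exact_mod_cast hm
    unfold f at h1
    linarith

/-- If the inferior arm comes first, the test statistic changes sign; the noise is symmetric, so `σ
= -1` reduces this case to the other. -/
lemma prob_never_rejects_ge (hW : IsPrimitives P mean W) (hΔ : mean .inferior < mean .optimal)
    (e : ℕ) {k₁ k₂ : ArmType} (hk : k₁ ≠ k₂) :
    β (mean .optimal - mean .inferior) ≤
      P.real {ω | ∀ m, ¬ Rejects (fun s => W s ω) k₁ k₂ e m} := by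
  have main : ∀ (σ : ℝ) a b, (∀ v, P.real {ω | v ≤ σ * W (.noise e) ω} = gaussianTail v) →
      (∀ ω m, |σ * W (.noise e) ω + lead (fun s => W s ω) a b m| =
        |W (.noise e) ω + ∑ j ∈ Finset.range m,
          (W (.reward k₁ (2 * e) j) ω - W (.reward k₂ (2 * e + 1) j) ω)|) →
      β (mean .optimal - mean .inferior) ≤
        P.real {ω | ∀ m, ¬ Rejects (fun s => W s ω) k₁ k₂ e m} := by
    intro σ a b h1 h2
    refine (prob_survive_ge hW hΔ a b e h1).trans (le_of_eq ?_)
    simp only [Rejects, not_lt, h2]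
  rcases k₁ with _ | _ <;> rcases k₂ with _ | _
  · exact absurd rfl hk
  · exact main 1 (2 * e) (2 * e + 1) (by simpa using prob_noise_ge hW e) fun ω m => by
      rw [one_mul, lead]
  · refine main (-1) (2 * e + 1) (2 * e) (by simpa using prob_neg_noise_ge hW e) fun ω m => ?_
    rw [← abs_neg, lead, Finset.sum_sub_distrib, Finset.sum_sub_distrib]
    congr 1
    ring
  · exact absurd rfl hk

end

/-! ### Epochs depend on disjoint sets of sources -/

/-- The epoch to which a source belongs (a meaningless default for coins). -/
def Source.epoch : Source → ℕ
  | .mark a => a / 2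
  | .reward _ a _ => a / 2
  | .noise e => e
  | .coin _ => 0

section Congr

variable {g : ℕ → ℝ} {w w' : Source → ℝ} {e : ℕ}

lemma drawnKind_congr (h : ∀ s : Source, s.epoch = e → w s = w' s) {a : ℕ}
    (ha : a / 2 = e) : drawnKind g w a = drawnKind g w' a := by
  unfold drawnKind
  rw [h (.mark a) ha]

lemma rejects_congr (h : ∀ s : Source, s.epoch = e → w s = w' s)
    (k₁ k₂ : ArmType) (m : ℕ) : Rejects w k₁ k₂ e m ↔ Rejects w' k₁ k₂ e m := by
  unfold Rejects
  rw [h (.noise e) rfl, Finset.sum_congr rfl fun j _ => by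
    rw [h (.reward k₁ (2 * e) j) (by simp [Source.epoch]),
      h (.reward k₂ (2 * e + 1) j) (by simp [Source.epoch]; omega)]]

lemma deviates_congr (h : ∀ s : Source, s.epoch = e → w s = w' s)
    (mean : ArmType → ℝ) (t : ℕ) :
    Deviates mean w e t ↔ Deviates mean w' e t := by
  unfold Deviates
  refine exists_congr fun k => exists_congr fun i => and_congr_right fun hi =>
    exists_congr fun s => ?_
  rw [Finset.sum_congr rfl fun j _ =>
    h (.reward k (2 * e + i) j) (by simp [Source.epoch]; omega)]

lemma abandoned_congr (h : ∀ s : Source, s.epoch = e → w s = w' s) :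
    Abandoned g w e ↔ Abandoned g w' e := by
  unfold Abandoned
  simp only [drawnKind_congr h (g := g) (show 2 * e / 2 = e by omega),
    drawnKind_congr h (g := g) (show (2 * e + 1) / 2 = e by omega), rejects_congr h]

end Congr

/-! ### Measurability of the events of an epoch -/

lemma measurableSet_rejects (k₁ k₂ : ArmType) (e m : ℕ) :
    MeasurableSet {w : Source → ℝ | Rejects w k₁ k₂ e m} := by
  unfold Rejects
  exact measurableSet_lt (by fun_prop) measurable_const

lemma measurableSet_deviates (mean : ArmType → ℝ) (e t : ℕ) :
    MeasurableSet {w : Source → ℝ | Deviates mean w e t} := by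
  simp only [Deviates, Set.ofPred_exists, Set.ofPred_and]
  refine MeasurableSet.iUnion fun k => MeasurableSet.iUnion fun i => (MeasurableSet.const _).inter <|
    MeasurableSet.iUnion fun s => (MeasurableSet.const _).inter <| (MeasurableSet.const _).inter <|
    measurableSet_le measurable_const (by fun_prop)

lemma measurableSet_drawnKind_eq (g : ℕ → ℝ) (a : ℕ) (k : ArmType) :
    MeasurableSet {w | drawnKind g w a = k} :=
  measurable_drawnKind g a (measurableSet_singleton k)

lemma measurableSet_abandoned (g : ℕ → ℝ) (e : ℕ) :
    MeasurableSet {w : Source → ℝ | Abandoned g w e} := by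
  simp only [Abandoned, Set.ofPred_exists]
  refine MeasurableSet.iUnion fun m => ?_
  have : {w : Source → ℝ | Rejects w (drawnKind g w (2 * e)) (drawnKind g w (2 * e + 1)) e m} =
      ⋃ k₁, ⋃ k₂, {w | drawnKind g w (2 * e) = k₁} ∩ ({w | drawnKind g w (2 * e + 1) = k₂} ∩
        {w | Rejects w k₁ k₂ e m}) := by
    ext w
    simp
  rw [this]
  exact MeasurableSet.iUnion fun k₁ => MeasurableSet.iUnion fun k₂ =>
    (measurableSet_drawnKind_eq g _ _).inter ((measurableSet_drawnKind_eq g _ _).inter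
      (measurableSet_rejects _ _ _ _))

lemma measurableSet_drawnKind_ne (g : ℕ → ℝ) (a b : ℕ) :
    MeasurableSet {w | drawnKind g w a ≠ drawnKind g w b} :=
  (measurableSet_eq_fun (measurable_drawnKind g a) (measurable_drawnKind g b)).compl

-- Counts become sums of indicators, to which linearity of the integral applies.
open Classical in
lemma epochBound_eq (mean : ArmType → ℝ) (g : ℕ → ℝ) (L : ℝ) (n : ℕ) (w : Source → ℝ) (e : ℕ) :
    epochBound mean g L n w e =
      (if drawnKind g w (2 * e) ≠ drawnKind g w (2 * e + 1) then (1 : ℝ) else 0) * L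
      + 226 * (1 + ∑ m ∈ Finset.range n, if ¬ Rejects w .inferior .inferior e m then (1 : ℝ) else 0)
      + 1 + ∑ t ∈ Finset.range n, if Deviates mean w e t then (1 : ℝ) else 0 := by
  unfold epochBound keepCount devCount
  simp only [Finset.card_filter]
  push_cast
  congr 4
  split_ifs <;> simp

lemma epochBound_congr {g : ℕ → ℝ} {w w' : Source → ℝ} {e : ℕ}
    (h : ∀ s : Source, s.epoch = e → w s = w' s) (mean : ArmType → ℝ) (L : ℝ) (n : ℕ) :
    epochBound mean g L n w e = epochBound mean g L n w' e := by
  classical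
  simp only [epochBound_eq, drawnKind_congr h (g := g) (show 2 * e / 2 = e by omega),
    drawnKind_congr h (g := g) (show (2 * e + 1) / 2 = e by omega), rejects_congr h,
    deviates_congr h]

/-! ### Expectations within an epoch and independence between epochs -/

section

variable {Ω : Type*} [MeasurableSpace Ω] {P : Measure Ω} [IsProbabilityMeasure P]
  {mean : ArmType → ℝ} {W : Source → Ω → ℝ} {c : ℝ} {g : ℕ → ℝ}

lemma integrable_ite (hW : IsPrimitives P mean W) {A : (Source → ℝ) → Prop} [DecidablePred A]
    (hA : MeasurableSet {w | A w}) :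
    Integrable (fun ω => if A (fun s => W s ω) then (1 : ℝ) else 0) P :=
  Integrable.of_mem_Icc 0 1 (Measurable.ite (measurable_sources hW hA) measurable_const
    measurable_const).aemeasurable (ae_of_all _ fun ω => by split_ifs <;> simp)

lemma integral_ite (hW : IsPrimitives P mean W) {A : (Source → ℝ) → Prop} [DecidablePred A]
    (hA : MeasurableSet {w | A w}) :
    ∫ ω, (if A (fun s => W s ω) then (1 : ℝ) else 0) ∂P = P.real {ω | A (fun s => W s ω)} := by
  rw [← integral_indicator_one (show MeasurableSet {ω | A (fun s => W s ω)} from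
    measurable_sources hW hA)]
  congr 1 with ω
  by_cases h : A fun s => W s ω <;> simp [h]

lemma measurable_epochBound (mean : ArmType → ℝ) (g : ℕ → ℝ) (L : ℝ) (n e : ℕ) :
    Measurable fun w => epochBound mean g L n w e := by
  classical
  simp only [epochBound_eq]
  have h1 : Measurable fun w => (if drawnKind g w (2 * e) ≠ drawnKind g w (2 * e + 1)
      then (1 : ℝ) else 0) :=
    Measurable.ite (measurableSet_drawnKind_ne g _ _) measurable_const measurable_const
  have h2 : ∀ m, Measurable fun w : Source → ℝ =>
      if ¬ Rejects w .inferior .inferior e m then (1 : ℝ) else 0 := fun m =>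
    Measurable.ite (measurableSet_rejects _ _ _ _).compl measurable_const measurable_const
  have h3 : ∀ t, Measurable fun w : Source → ℝ => if Deviates mean w e t then (1 : ℝ) else 0 :=
    fun t => Measurable.ite (measurableSet_deviates _ _ _) measurable_const measurable_const
  exact (((h1.mul_const L).add (((Finset.measurable_sum _ fun m _ => h2 m).const_add 1).const_mul
    226)).add_const 1).add (Finset.measurable_sum _ fun t _ => h3 t)

/-- The probability that the two arms of epoch `e` have different types. -/
def mixProb (P : Measure Ω) (g : ℕ → ℝ) (W : Source → Ω → ℝ) (e : ℕ) : ℝ :=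
  P.real {ω | drawnKind g (fun s => W s ω) (2 * e) ≠ drawnKind g (fun s => W s ω) (2 * e + 1)}

/-- The probability that all epochs before epoch `e` are abandoned. -/
def reachProb (P : Measure Ω) (g : ℕ → ℝ) (W : Source → Ω → ℝ) (e : ℕ) : ℝ :=
  P.real {ω | ∀ i < e, Abandoned g (fun s => W s ω) i}

/-- An upper bound for the part of `E (epochBound ..)` that does not grow with the horizon. -/
def epochConst : ℝ :=
  226 * (2 + 6 * ∑' n : ℕ, 1 / (n : ℝ) ^ 2) + 1 + 8 * ∑' n : ℕ, 1 / (n : ℝ) ^ 2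

lemma summable_one_div_sq : Summable fun n : ℕ => 1 / (n : ℝ) ^ 2 :=
  Real.summable_one_div_nat_pow.2 one_lt_two

lemma epochConst_nonneg : 0 ≤ epochConst := by
  have : 0 ≤ ∑' n : ℕ, 1 / (n : ℝ) ^ 2 := tsum_nonneg fun n => by positivity
  unfold epochConst
  positivity

lemma integrable_epochBound (hW : IsPrimitives P mean W) (L : ℝ) (n e : ℕ) :
    Integrable (fun ω => epochBound mean g L n (fun s => W s ω) e) P := by
  classical
  simp only [epochBound_eq]
  have h1 := (integrable_ite hW (measurableSet_drawnKind_ne g (2 * e) (2 * e + 1))).mul_const L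
  have h2 := integrable_finsetSum (Finset.range n) fun m _ =>
    integrable_ite hW (A := fun w => ¬ Rejects w .inferior .inferior e m)
      (measurableSet_rejects .inferior .inferior e m).compl
  have h3 := integrable_finsetSum (Finset.range n) fun t _ =>
    integrable_ite hW (measurableSet_deviates mean e t)
  exact ((h1.add (((integrable_const 1).add h2).const_mul 226)).add (integrable_const 1)).add h3

lemma integral_epochBound_le (hW : IsPrimitives P mean W) (L : ℝ) (n e : ℕ) :
    ∫ ω, epochBound mean g L n (fun s => W s ω) e ∂P ≤ mixProb P g W e * L + epochConst := by
  classical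
  simp only [epochBound_eq]
  have h1 := (integrable_ite hW (measurableSet_drawnKind_ne g (2 * e) (2 * e + 1))).mul_const L
  have h2' := fun m => integrable_ite hW (A := fun w => ¬ Rejects w .inferior .inferior e m)
    (measurableSet_rejects .inferior .inferior e m).compl
  have h2 := integrable_finsetSum (Finset.range n) fun m _ => h2' m
  have h3' := fun t => integrable_ite hW (measurableSet_deviates mean e t)
  have h3 := integrable_finsetSum (Finset.range n) fun t _ => h3' t
  have h4 := ((integrable_const (μ := P) (1 : ℝ)).add h2).const_mul 226
  have e2 : ∫ ω, ∑ m ∈ Finset.range n, (if ¬ Rejects (fun s => W s ω) .inferior .inferior e m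
      then (1 : ℝ) else 0) ∂P ≤ 1 + 6 * ∑' n : ℕ, 1 / (n : ℝ) ^ 2 := by
    rw [integral_finsetSum _ fun m _ => h2' m]
    -- At `m = 0` the tail bound is void, since `1 / 0 ^ 2` is `0`; this term is bounded by `1`
    -- separately.
    have hb : ∀ m ∈ Finset.range n, ∫ ω, (if ¬ Rejects (fun s => W s ω) .inferior .inferior e m
        then (1 : ℝ) else 0) ∂P ≤ (if m = 0 then 1 else 0) + 6 * (1 / (m : ℝ) ^ 2) := by
      intro m _
      rw [integral_ite hW (A := fun w => ¬ Rejects w .inferior .inferior e m)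
        (measurableSet_rejects .inferior .inferior e m).compl]
      rcases Nat.eq_zero_or_pos m with rfl | hm
      · simpa using measureReal_le_one
      · rw [if_neg hm.ne', zero_add]
        exact prob_not_rejects_le hW e hm
    refine (Finset.sum_le_sum hb).trans ?_
    rw [Finset.sum_add_distrib, ← Finset.mul_sum]
    gcongr
    · rw [Finset.sum_ite_eq']
      split_ifs <;> simp
    · exact summable_one_div_sq.sum_le_tsum _ fun i _ => by positivity
  have e3 : ∫ ω, ∑ t ∈ Finset.range n, (if Deviates mean (fun s => W s ω) e t
      then (1 : ℝ) else 0) ∂P ≤ 8 * ∑' n : ℕ, 1 / (n : ℝ) ^ 2 := by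
    rw [integral_finsetSum _ fun t _ => h3' t]
    have hb : ∀ t ∈ Finset.range n, ∫ ω, (if Deviates mean (fun s => W s ω) e t
        then (1 : ℝ) else 0) ∂P ≤ 8 * (1 / (t : ℝ) ^ 2) := by
      intro t _
      rw [integral_ite hW (measurableSet_deviates mean e t)]
      exact prob_deviates_le hW e t
    refine (Finset.sum_le_sum hb).trans ?_
    rw [← Finset.mul_sum]
    gcongr
    exact summable_one_div_sq.sum_le_tsum _ fun i _ => by positivity
  have e1 := integral_ite hW (measurableSet_drawnKind_ne g (2 * e) (2 * e + 1))
  have split := integral_add ((h1.add h4).add (integrable_const 1)) h3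
  have split2 := integral_add (h1.add h4) (integrable_const (μ := P) (1 : ℝ))
  have split3 := integral_add h1 h4
  have split4 := integral_add (integrable_const (μ := P) (1 : ℝ)) h2
  simp only [Pi.add_apply] at split split2 split3 split4
  rw [split, split2, split3, integral_mul_const, integral_const_mul, split4, e1]
  simp only [integral_const, probReal_univ, smul_eq_mul, mul_one]
  unfold mixProb epochConst
  linarith

lemma dependsOn_abandoned_lt (g : ℕ → ℝ) (e : ℕ) :
    DependsOn (fun w => ∀ i < e, Abandoned g w i) {s : Source | s.epoch < e} := by
  intro w w' h
  refine propext (forall₂_congr fun i hi => abandoned_congr fun s hs => h s ?_)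
  exact (show s.epoch < e by omega)

lemma measurableSet_abandoned_lt (g : ℕ → ℝ) (e : ℕ) :
    MeasurableSet {w : Source → ℝ | ∀ i < e, Abandoned g w i} := by
  simp only [Set.ofPred_forall]
  exact MeasurableSet.iInter fun i => MeasurableSet.iInter fun _ => measurableSet_abandoned g i

lemma disjoint_epoch_lt (e : ℕ) :
    Disjoint {s : Source | s.epoch < e} {s : Source | s.epoch = e} :=
  Set.disjoint_left.2 fun s (h : s.epoch < e) (h' : s.epoch = e) => by omega

-- Whether epoch `e` is reached is decided by the sources of earlier epochs, its bound by its own.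
open Classical in
lemma integral_reach_mul_epochBound (hW : IsPrimitives P mean W) (L : ℝ) (n e : ℕ) :
    ∫ ω, (if ∀ i < e, Abandoned g (fun s => W s ω) i then (1 : ℝ) else 0) *
      epochBound mean g L n (fun s => W s ω) e ∂P =
    reachProb P g W e * ∫ ω, epochBound mean g L n (fun s => W s ω) e ∂P := by
  have hm := measurableSet_abandoned_lt g e
  have h := indepFun_of_dependsOn hW.measurable hW.indep
    (F := fun w => if ∀ i < e, Abandoned g w i then (1 : ℝ) else 0)
    (G := fun w => epochBound mean g L n w e)
    (Measurable.ite hm measurable_const measurable_const)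
    (measurable_epochBound mean g L n e)
    (fun w w' h => by
      have := dependsOn_abandoned_lt g e h
      simp only [this])
    (fun w w' h => epochBound_congr h mean L n) (disjoint_epoch_lt e)
  rw [h.integral_fun_mul_eq_mul_integral (integrable_ite hW hm).aestronglyMeasurable
    (integrable_epochBound hW L n e).aestronglyMeasurable, integral_ite hW hm]
  rfl

lemma reachProb_succ (hW : IsPrimitives P mean W) (e : ℕ) :
    reachProb P g W (e + 1) =
      reachProb P g W e * P.real {ω | Abandoned g (fun s => W s ω) e} := by
  unfold reachProb
  rw [← prob_and_eq_mul hW (measurableSet_abandoned_lt g e) (measurableSet_abandoned g e)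
    (dependsOn_abandoned_lt g e) (fun w w' h => propext (abandoned_congr h)) (disjoint_epoch_lt e)]
  simp only [Nat.forall_lt_succ_right]

/-! ### The law of the types -/

lemma prob_mark_lt (hW : IsPrimitives P mean W) (hg : IsEndogenousReservoir c g) (a : ℕ) :
    P.real {ω | drawnKind g (fun s => W s ω) a = .optimal} = g a := by
  have h1 : {ω | drawnKind g (fun s => W s ω) a = .optimal} = W (.mark a) ⁻¹' Set.Iio (g a) := by
    ext ω
    simp [drawnKind]
  have hga := hg.mem a
  have h2 : Set.Iio (g a) ∩ Set.Icc 0 1 = Set.Ico 0 (g a) := by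
    ext x
    simp only [Set.mem_inter_iff, Set.mem_Iio, Set.mem_Icc, Set.mem_Ico]
    have := hga.2
    have := hg.lt_one
    constructor
    · rintro ⟨h, h', _⟩; exact ⟨h', h⟩
    · rintro ⟨h, h'⟩; exact ⟨h', h, by linarith⟩
  rw [h1, ← map_measureReal_apply (hW.measurable _) measurableSet_Iio, hW.mark_law,
    measureReal_restrict_apply measurableSet_Iio, h2, Real.volume_real_Ico_of_le hga.1.le, sub_zero]

lemma prob_mark_ge (hW : IsPrimitives P mean W) (hg : IsEndogenousReservoir c g) (a : ℕ) :
    P.real {ω | drawnKind g (fun s => W s ω) a = .inferior} = 1 - g a := by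
  have h := probReal_compl_eq_one_sub (μ := P)
    (measurable_sources hW (measurableSet_drawnKind_eq g a .optimal))
  have hset : ((fun ω s => W s ω) ⁻¹' {w | drawnKind g w a = .optimal}) =
    {ω | drawnKind g (fun s => W s ω) a = .optimal} := rfl
  rw [hset] at h
  rw [← prob_mark_lt hW hg a, ← h]
  congr 1
  ext ω
  change drawnKind g (fun s => W s ω) a = .inferior ↔
    ¬ drawnKind g (fun s => W s ω) a = .optimal
  cases drawnKind g (fun s => W s ω) a <;> simp

lemma dependsOn_drawnKind (g : ℕ → ℝ) (a : ℕ) (k : ArmType) :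
    DependsOn (fun w => drawnKind g w a = k) {Source.mark a} := by
  intro w w' h
  have : w (.mark a) = w' (.mark a) := h _ rfl
  simp only [drawnKind, this]

lemma prob_kinds (hW : IsPrimitives P mean W) (e : ℕ) (k₁ k₂ : ArmType) :
    P.real {ω | drawnKind g (fun s => W s ω) (2 * e) = k₁ ∧
      drawnKind g (fun s => W s ω) (2 * e + 1) = k₂} =
    P.real {ω | drawnKind g (fun s => W s ω) (2 * e) = k₁} *
      P.real {ω | drawnKind g (fun s => W s ω) (2 * e + 1) = k₂} :=
  prob_and_eq_mul hW (measurableSet_drawnKind_eq g _ _) (measurableSet_drawnKind_eq g _ _)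
    (dependsOn_drawnKind g _ _) (dependsOn_drawnKind g _ _) (by simp)

lemma measureReal_ne_inter (hW : IsPrimitives P mean W) {a b : ℕ} {A : (Source → ℝ) → Prop}
    (hA : MeasurableSet {w | A w}) :
    P.real {ω | drawnKind g (fun s => W s ω) a ≠ drawnKind g (fun s => W s ω) b ∧
      A fun s => W s ω} =
    P.real {ω | (drawnKind g (fun s => W s ω) a = .optimal ∧
      drawnKind g (fun s => W s ω) b = .inferior) ∧ A fun s => W s ω} +
    P.real {ω | (drawnKind g (fun s => W s ω) a = .inferior ∧
      drawnKind g (fun s => W s ω) b = .optimal) ∧ A fun s => W s ω} := by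
  rw [← measureReal_union]
  · congr 1
    ext ω
    change (_ ≠ _ ∧ _) ↔ ((_ ∧ _) ∧ _) ∨ ((_ ∧ _) ∧ _)
    cases drawnKind g (fun s => W s ω) a <;> cases drawnKind g (fun s => W s ω) b <;> simp
  · refine Set.disjoint_left.2 ?_
    rintro ω ⟨⟨h, -⟩, -⟩ ⟨⟨h', -⟩, -⟩
    simp [h] at h'
  · exact measurable_sources hW (((measurableSet_drawnKind_eq g _ _).inter
      (measurableSet_drawnKind_eq g _ _)).inter hA)

lemma mixProb_eq (hW : IsPrimitives P mean W) (hg : IsEndogenousReservoir c g) (e : ℕ) :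
    mixProb P g W e = g (2 * e) * (1 - g (2 * e + 1)) + (1 - g (2 * e)) * g (2 * e + 1) := by
  have h := measureReal_ne_inter (g := g) hW (a := 2 * e) (b := 2 * e + 1) (A := fun _ => True)
    MeasurableSet.univ
  simp only [and_true, prob_kinds hW, prob_mark_lt hW hg, prob_mark_ge hW hg] at h
  exact h

/-- Each of the two mixed configurations of types is survived with conditional probability at least
`β`; survival of equal types is ignored. -/
lemma prob_abandoned_le (hW : IsPrimitives P mean W) (hΔ : mean .inferior < mean .optimal)
    (e : ℕ) : P.real {ω | Abandoned g (fun s => W s ω) e} ≤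
      1 - β (mean .optimal - mean .inferior) * mixProb P g W e := by
  set b := β (mean .optimal - mean .inferior)
  have hmix := measureReal_ne_inter (g := g) hW (a := 2 * e) (b := 2 * e + 1) (A := fun _ => True)
    MeasurableSet.univ
  have hnot := measureReal_ne_inter (g := g) hW (a := 2 * e) (b := 2 * e + 1)
    (A := fun w => ¬ Abandoned g w e) (measurableSet_abandoned g e).compl
  simp only [and_true] at hmix
  have key : ∀ k₁ k₂ : ArmType, k₁ ≠ k₂ →
      b * P.real {ω | drawnKind g (fun s => W s ω) (2 * e) = k₁ ∧
        drawnKind g (fun s => W s ω) (2 * e + 1) = k₂} ≤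
      P.real {ω | (drawnKind g (fun s => W s ω) (2 * e) = k₁ ∧
        drawnKind g (fun s => W s ω) (2 * e + 1) = k₂) ∧ ¬ Abandoned g (fun s => W s ω) e} := by
    intro k₁ k₂ hk
    -- With the types fixed as `k₁` and `k₂`, the test involves no marks, so it is independent of
    -- the draw of the types.
    have hmul := prob_and_eq_mul hW
      (A := fun w => drawnKind g w (2 * e) = k₁ ∧ drawnKind g w (2 * e + 1) = k₂)
      (B := fun w => ∀ m, ¬ Rejects w k₁ k₂ e m)
      (S := Set.range Source.mark) (T := (Set.range Source.mark)ᶜ)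
      ((measurableSet_drawnKind_eq g _ _).inter (measurableSet_drawnKind_eq g _ _))
      (by
        simp only [Set.ofPred_forall]
        exact MeasurableSet.iInter fun m => (measurableSet_rejects _ _ _ _).compl)
      (fun w w' h => by
        simp only [drawnKind, h (.mark _) ⟨_, rfl⟩])
      (fun w w' h => by
        have h1 : w (.noise e) = w' (.noise e) := h _ (by simp)
        have h2 : ∀ k a j, w (.reward k a j) = w' (.reward k a j) := fun k a j => h _ (by simp)
        simp only [Rejects, h1, h2])
      disjoint_compl_right
    have hsub : {ω | (drawnKind g (fun s => W s ω) (2 * e) = k₁ ∧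
        drawnKind g (fun s => W s ω) (2 * e + 1) = k₂) ∧
        ∀ m, ¬ Rejects (fun s => W s ω) k₁ k₂ e m} ⊆
      {ω | (drawnKind g (fun s => W s ω) (2 * e) = k₁ ∧
        drawnKind g (fun s => W s ω) (2 * e + 1) = k₂) ∧ ¬ Abandoned g (fun s => W s ω) e} := by
      rintro ω ⟨⟨h1, h2⟩, h3⟩
      refine ⟨⟨h1, h2⟩, ?_⟩
      rintro ⟨m, hm⟩
      rw [h1, h2] at hm
      exact h3 m hm
    refine le_trans ?_ (measureReal_mono hsub (measure_ne_top _ _))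
    rw [hmul, mul_comm]
    gcongr
    exact prob_never_rejects_ge hW hΔ e hk
  have hle : P.real {ω | drawnKind g (fun s => W s ω) (2 * e) ≠
      drawnKind g (fun s => W s ω) (2 * e + 1) ∧ ¬ Abandoned g (fun s => W s ω) e} ≤
      P.real {ω | ¬ Abandoned g (fun s => W s ω) e} :=
    measureReal_mono (fun ω h => h.2) (measure_ne_top _ _)
  have hcompl : P.real {ω | ¬ Abandoned g (fun s => W s ω) e} =
      1 - P.real {ω | Abandoned g (fun s => W s ω) e} :=
    probReal_compl_eq_one_sub (μ := P) (measurable_sources hW (measurableSet_abandoned g e))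
  have h1 := key .optimal .inferior (by simp)
  have h2 := key .inferior .optimal (by simp)
  have : b * mixProb P g W e ≤ P.real {ω | ¬ Abandoned g (fun s => W s ω) e} := by
    unfold mixProb
    rw [hmix, mul_add]
    linarith
  linarith

/-! ### Probabilities of reaching an epoch -/

lemma mixProb_nonneg (P : Measure Ω) (g : ℕ → ℝ) (W : Source → Ω → ℝ) (e : ℕ) :
    0 ≤ mixProb P g W e := measureReal_nonneg

lemma reachProb_nonneg (P : Measure Ω) (g : ℕ → ℝ) (W : Source → Ω → ℝ) (e : ℕ) :
    0 ≤ reachProb P g W e := measureReal_nonneg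

/-- Each term, multiplied by `β`, is at most `reachProb e - reachProb (e + 1)`, so the sum
telescopes. In this way the coefficient of `log n` does not depend on how fast the series in `bound`
converges. -/
lemma sum_reachProb_mul_mixProb_le (hW : IsPrimitives P mean W)
    (hΔ : mean .inferior < mean .optimal) (n : ℕ) :
    ∑ e ∈ Finset.range n, reachProb P g W e * mixProb P g W e ≤
      1 / β (mean .optimal - mean .inferior) := by
  set b := β (mean .optimal - mean .inferior) with hb
  have hb0 : 0 < b := β_pos _
  have : b * ∑ e ∈ Finset.range n, reachProb P g W e * mixProb P g W e ≤
      1 - reachProb P g W n := by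
    induction n with
    | zero => simp [reachProb]
    | succ n ih =>
      rw [Finset.sum_range_succ, mul_add, reachProb_succ hW]
      have h1 := prob_abandoned_le (g := g) hW hΔ n
      have h2 := mul_le_mul_of_nonneg_left h1 (reachProb_nonneg P g W n)
      rw [← hb] at h2
      linarith
  rw [le_div_iff₀ hb0]
  linarith [reachProb_nonneg P g W n]

lemma reachProb_le_exp (hW : IsPrimitives P mean W) (hΔ : mean .inferior < mean .optimal)
    (n : ℕ) : reachProb P g W n ≤ Real.exp (-β (mean .optimal - mean .inferior) *
      ∑ e ∈ Finset.range n, mixProb P g W e) := by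
  induction n with
  | zero => simp [reachProb]
  | succ n ih =>
    rw [reachProb_succ hW, Finset.sum_range_succ, mul_add, Real.exp_add]
    refine mul_le_mul ih ?_ measureReal_nonneg (Real.exp_nonneg _)
    refine (prob_abandoned_le hW hΔ n).trans ?_
    have := Real.add_one_le_exp (-β (mean .optimal - mean .inferior) * mixProb P g W n)
    linarith

/-- Write `p = g (2 * j)` and `q = g (2 * j + 1)`, so `mixProb = p + q * (1 - 2 * p)`. This is at
least `p` once `p ≤ 1/2`, and then the given series is a majorant up to a factor. If `p` always
exceeds `1/2`, then `mixProb ≥ p * (1 - q) ≥ (1 - c) / 2` and the decay is geometric. -/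
lemma summable_reachProb (hW : IsPrimitives P mean W) (hΔ : mean .inferior < mean .optimal)
    (hg : IsEndogenousReservoir c g)
    (hs : Summable fun k : ℕ => Real.exp (-β (mean .optimal - mean .inferior) *
      ∑ j ∈ Finset.range k, g (2 * j))) : Summable (reachProb P g W) := by
  set b := β (mean .optimal - mean .inferior) with hb
  have hb0 : 0 < b := β_pos _
  have hmono : ∀ j, g (2 * j + 1) ≤ g (2 * j) := fun j => hg.antitone (by omega)
  by_cases hJ : ∃ J, g (2 * J) ≤ 1 / 2
  · obtain ⟨J, hJ⟩ := hJ
    -- The first `J` epochs cost at most `1` each, hence the factor `exp (b * J)` below.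
    have hle : ∀ j, g (2 * j) ≤ mixProb P g W j + if j < J then 1 else 0 := by
      intro j
      have h1 := hg.mem (2 * j)
      have h2 := hg.mem (2 * j + 1)
      have := hg.lt_one
      split_ifs with hj
      · linarith [mixProb_nonneg P g W j, h1.2]
      · have h3 : g (2 * j) ≤ 1 / 2 := (hg.antitone (by omega)).trans hJ
        rw [mixProb_eq hW hg]
        nlinarith [h2.1, mul_nonneg h2.1.le (show 0 ≤ 1 - 2 * g (2 * j) by linarith)]
    have hsum : ∀ k, ∑ j ∈ Finset.range k, g (2 * j) ≤
        ∑ j ∈ Finset.range k, mixProb P g W j + J := by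
      intro k
      refine (Finset.sum_le_sum fun j _ => hle j).trans ?_
      rw [Finset.sum_add_distrib]
      gcongr
      rw [← Finset.sum_filter, Finset.sum_const, nsmul_eq_mul, mul_one]
      have : ((Finset.range k).filter (· < J)).card ≤ (Finset.range J).card :=
        Finset.card_le_card fun j hj => by simp at hj ⊢; exact hj.2
      rw [Finset.card_range] at this
      exact_mod_cast this
    refine Summable.of_nonneg_of_le (reachProb_nonneg P g W) (fun k => ?_)
      (hs.mul_left (Real.exp (b * J)))
    refine (reachProb_le_exp hW hΔ k).trans ?_
    rw [← Real.exp_add, ← hb]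
    gcongr
    nlinarith [hsum k]
  · push Not at hJ
    have hlow : ∀ j, (1 - c) / 2 ≤ mixProb P g W j := by
      intro j
      rw [mixProb_eq hW hg]
      have h0 := hJ j
      have h1 := hg.mem (2 * j)
      have h2 := hg.mem (2 * j + 1)
      have hc := hg.lt_one
      have h3 := hmono j
      nlinarith [mul_nonneg (show 0 ≤ 1 - g (2 * j) by linarith [h1.2]) h2.1.le, h1.2, h2.2,
        mul_nonneg (show 0 ≤ g (2 * j) - 1 / 2 by linarith)
          (show 0 ≤ 1 - g (2 * j + 1) by linarith [h2.2])]
    have hr : Real.exp (-b * ((1 - c) / 2)) < 1 := by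
      rw [Real.exp_lt_one_iff]
      have := hg.lt_one
      nlinarith [mul_pos hb0 (show 0 < (1 - c) / 2 by linarith)]
    refine Summable.of_nonneg_of_le (reachProb_nonneg P g W) (fun k => ?_)
      (summable_geometric_of_lt_one (Real.exp_nonneg _) hr)
    refine (reachProb_le_exp hW hΔ k).trans ?_
    rw [← Real.exp_nat_mul, ← hb]
    refine Real.exp_le_exp.2 ?_
    have : ∑ j ∈ Finset.range k, (1 - c) / 2 ≤ ∑ j ∈ Finset.range k, mixProb P g W j :=
      Finset.sum_le_sum fun j _ => hlow j
    rw [Finset.sum_const, Finset.card_range, nsmul_eq_mul] at this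
    nlinarith

/-- The regret is at most `8 / (Δ β) log n` up to a constant if the series of the bound converges. -/
lemma integral_regret_le (hW : IsPrimitives P mean W) (hΔ : mean .inferior < mean .optimal)
    {tie : TieRule} (htie : ∀ t, Measurable (fun p : (ℕ → ℕ × ℝ) × ℝ => tie t p.1 p.2))
    (hs : Summable (reachProb P g W)) (n : ℕ) :
    ∫ ω, regret mean g tie (fun s => W s ω) n ∂P ≤
      8 / ((mean .optimal - mean .inferior) * β (mean .optimal - mean .inferior)) * Real.log n +
        (mean .optimal - mean .inferior) * (epochConst * ∑' e, reachProb P g W e) := by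
  classical
  set Δ := mean .optimal - mean .inferior with hΔdef
  have h0 : 0 < Δ := sub_pos.2 hΔ
  have hb0 := β_pos Δ
  set L := 8 * Real.log n / Δ ^ 2 with hL
  have hL0 : 0 ≤ L := by have := Real.log_natCast_nonneg n; positivity
  have hm := fun e => measurableSet_abandoned_lt g e
  have hint : ∀ e, Integrable (fun ω => (if ∀ i < e, Abandoned g (fun s => W s ω) i
      then (1 : ℝ) else 0) * epochBound mean g L n (fun s => W s ω) e) P := fun e => by
    refine (integrable_indicator_mul hW (hm e) (integrable_epochBound (g := g) hW L n e)).congr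
      (ae_of_all _ fun ω => ?_)
    by_cases h : ∀ i < e, Abandoned g (fun s => W s ω) i
    · simp only [if_pos h, Set.indicator_of_mem (show (fun s => W s ω) ∈
        {w | ∀ i < e, Abandoned g w i} from h), Pi.one_apply]
    · simp only [if_neg h, Set.indicator_of_notMem (show (fun s => W s ω) ∉
        {w | ∀ i < e, Abandoned g w i} from h)]
  have hpl : ∫ ω, ∑ t ∈ Finset.range n, (if drawnKind g (fun s => W s ω)
        (played g tie (fun s => W s ω) t) = .inferior then (1 : ℝ) else 0) ∂P ≤
      1 / β Δ * L + epochConst * ∑' e, reachProb P g W e := by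
    calc _ ≤ ∫ ω, ∑ e ∈ Finset.range (n + 1), (if ∀ i < e, Abandoned g (fun s => W s ω) i
          then (1 : ℝ) else 0) * epochBound mean g L n (fun s => W s ω) e ∂P := by
          refine integral_mono ?_ (integrable_finsetSum _ fun e _ => hint e) fun ω => ?_
          · exact integrable_finsetSum _ fun t _ => integrable_ite hW
              (A := fun w => drawnKind g w (played g tie w t) = .inferior)
              (measurable_drawnKind_played g htie t (measurableSet_singleton _))
          · exact sum_played_inferior_le tie (fun s => W s ω) hΔ hL0 fun t h2 ht => by
              rw [hL, hΔdef]
              gcongr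
      _ = ∑ e ∈ Finset.range (n + 1), reachProb P g W e *
          ∫ ω, epochBound mean g L n (fun s => W s ω) e ∂P := by
          rw [integral_finsetSum _ fun e _ => hint e]
          exact Finset.sum_congr rfl fun e _ => integral_reach_mul_epochBound hW L n e
      _ ≤ ∑ e ∈ Finset.range (n + 1), reachProb P g W e * (mixProb P g W e * L + epochConst) := by
          gcongr with e _
          · exact reachProb_nonneg P g W e
          · exact integral_epochBound_le hW L n e
      _ = (∑ e ∈ Finset.range (n + 1), reachProb P g W e * mixProb P g W e) * L +
          epochConst * ∑ e ∈ Finset.range (n + 1), reachProb P g W e := by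
          rw [Finset.sum_mul, Finset.mul_sum, ← Finset.sum_add_distrib]
          exact Finset.sum_congr rfl fun e _ => by ring
      _ ≤ _ := by
          gcongr
          · exact sum_reachProb_mul_mixProb_le hW hΔ _
          · exact epochConst_nonneg
          · exact hs.sum_le_tsum _ fun e _ => reachProb_nonneg P g W e
  rw [integral_regret hW hΔ g htie]
  refine (mul_le_mul_of_nonneg_left hpl h0.le).trans (le_of_eq ?_)
  rw [hL, mul_add]
  congr 1
  field_simp

end

/-! ### The bound -/

lemma bound_eq_ofReal {c Δ : ℝ} {g : ℕ → ℝ} (hc : 0 ≤ 16 * c / Δ)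
    (hs : Summable fun k : ℕ => Real.exp (-β Δ * ∑ j ∈ Finset.range k, g (2 * j))) :
    bound c Δ g = ENNReal.ofReal (16 * c / Δ *
      ∑' k : ℕ, Real.exp (-β Δ * ∑ j ∈ Finset.range k, g (2 * j))) := by
  rw [bound, ENNReal.ofReal_mul hc,
    ENNReal.ofReal_tsum_of_nonneg (fun _ => Real.exp_nonneg _) hs]

lemma summable_of_bound_ne_top {c Δ : ℝ} {g : ℕ → ℝ} (hc : 0 < 16 * c / Δ)
    (h : bound c Δ g ≠ ⊤) :
    Summable fun k : ℕ => Real.exp (-β Δ * ∑ j ∈ Finset.range k, g (2 * j)) := by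
  have h1 : ∑' k : ℕ, ENNReal.ofReal (Real.exp (-β Δ * ∑ j ∈ Finset.range k, g (2 * j))) ≠ ⊤ := by
    intro htop
    refine h ?_
    rw [bound, htop, ENNReal.mul_top (by simpa using hc)]
  refine (ENNReal.summable_toReal h1).congr fun k => ?_
  rw [ENNReal.toReal_ofReal (Real.exp_nonneg _)]

/-- Since `g ≤ c`, the series dominates the geometric one with ratio `exp (-x)`, where `x = β Δ *
c`, and `1 / (1 - exp (-x)) ≥ 1 / x`. The factor `c` in front cancels. -/
lemma le_bound {c Δ : ℝ} {g : ℕ → ℝ} (h0 : 0 < Δ) (hg : IsEndogenousReservoir c g)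
    (hs : Summable fun k : ℕ => Real.exp (-β Δ * ∑ j ∈ Finset.range k, g (2 * j))) :
    ENNReal.ofReal (16 / (Δ * β Δ)) ≤ bound c Δ g := by
  have hc := hg.pos
  have hb := β_pos Δ
  rw [bound_eq_ofReal (by positivity) hs]
  refine ENNReal.ofReal_le_ofReal ?_
  have hr : Real.exp (-(β Δ * c)) < 1 := by
    rw [Real.exp_lt_one_iff]
    have := mul_pos hb hc
    linarith
  have hgeo := tsum_geometric_of_lt_one (Real.exp_nonneg _) hr
  have hle : (1 - Real.exp (-(β Δ * c)))⁻¹ ≤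
      ∑' k : ℕ, Real.exp (-β Δ * ∑ j ∈ Finset.range k, g (2 * j)) := by
    rw [← hgeo]
    refine Summable.tsum_le_tsum (fun k => ?_)
      (summable_geometric_of_lt_one (Real.exp_nonneg _) hr) hs
    rw [← Real.exp_nat_mul]
    refine Real.exp_le_exp.2 ?_
    have : ∑ j ∈ Finset.range k, g (2 * j) ≤ ∑ j ∈ Finset.range k, c :=
      Finset.sum_le_sum fun j _ => (hg.mem _).2
    rw [Finset.sum_const, Finset.card_range, nsmul_eq_mul] at this
    nlinarith
  have h1 : 1 / (β Δ * c) ≤ (1 - Real.exp (-(β Δ * c)))⁻¹ := by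
    rw [one_div]
    refine inv_anti₀ (by linarith) ?_
    linarith [Real.add_one_le_exp (-(β Δ * c))]
  calc 16 / (Δ * β Δ) = 16 * c / Δ * (1 / (β Δ * c)) := by field_simp
    _ ≤ _ := by gcongr; exact h1.trans hle

lemma bound_const_le {c Δ : ℝ} {g : ℕ → ℝ} (h0 : 0 < Δ) (hg : IsEndogenousReservoir c g)
    (hconst : ∀ u, g u = c) : bound c Δ g ≤ ENNReal.ofReal (32 / (Δ * β Δ)) := by
  have hc := hg.pos
  have hb := β_pos Δ
  set x := β Δ * c with hx
  have hx0 : 0 < x := mul_pos hb hc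
  have hx1 : x ≤ 1 := by
    have := β_le Δ
    have := hg.lt_one
    nlinarith
  have hr : Real.exp (-x) < 1 := by
    rw [Real.exp_lt_one_iff]
    linarith
  have hterm : (fun k : ℕ => Real.exp (-β Δ * ∑ j ∈ Finset.range k, g (2 * j))) =
      fun k => Real.exp (-x) ^ k := by
    funext k
    simp only [hconst, Finset.sum_const, Finset.card_range, nsmul_eq_mul]
    rw [← Real.exp_nat_mul, hx]
    congr 1
    ring
  have hs : Summable fun k : ℕ => Real.exp (-β Δ * ∑ j ∈ Finset.range k, g (2 * j)) := by
    rw [hterm]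
    exact summable_geometric_of_lt_one (Real.exp_nonneg _) hr
  rw [bound_eq_ofReal (by positivity) hs, hterm,
    tsum_geometric_of_lt_one (Real.exp_nonneg _) hr]
  refine ENNReal.ofReal_le_ofReal ?_
  -- From `exp (-x) ≤ 1 / (1 + x)` and `(1 + x) * (1 - x / 2) ≥ 1`, the latter because `0 ≤ x ≤ 1`.
  have h1 : Real.exp (-x) ≤ 1 - x / 2 := by
    have h2 := Real.add_one_le_exp x
    have h3 : Real.exp (-x) ≤ (x + 1)⁻¹ := by
      rw [Real.exp_neg]
      exact inv_anti₀ (by linarith) h2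
    refine h3.trans ?_
    rw [inv_le_iff_one_le_mul₀ (by linarith)]
    nlinarith
  calc 16 * c / Δ * (1 - Real.exp (-x))⁻¹ ≤ 16 * c / Δ * (x / 2)⁻¹ := by
        gcongr
        linarith
    _ = 32 / (Δ * β Δ) := by rw [hx]; field_simp; norm_num

end

end Bandit

/-! ### The theorem -/

theorem mainTheorem3 {Ω : Type*} [MeasurableSpace Ω] (P : Measure Ω) [IsProbabilityMeasure P]
    (mean : Bandit.ArmType → ℝ) (Δ : ℝ) (hΔ : Δ = mean .optimal - mean .inferior) (hpos : 0 < Δ)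
    (W : Bandit.Source → Ω → ℝ) (hW : Bandit.IsPrimitives P mean W)
    (c : ℝ) (g : ℕ → ℝ) (hg : Bandit.IsEndogenousReservoir c g)
    (tie : Bandit.TieRule)
    (htie : ∀ t, Measurable (fun p : (ℕ → ℕ × ℝ) × ℝ => tie t p.1 p.2)) :
    (∀ n, Integrable (fun ω => Bandit.regret mean g tie (fun s => W s ω) n) P) ∧
    limsup (fun n : ℕ =>
        (((∫ ω, Bandit.regret mean g tie (fun s => W s ω) n ∂P) / Real.log n : ℝ) : EReal)) atTop
      ≤ (Bandit.bound c Δ g : EReal) ∧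
    ((∀ u, g u = c) →
      Bandit.bound c Δ g ≤ ENNReal.ofReal (32 / (Δ * Bandit.β Δ))) := by
  have hlt : mean .inferior < mean .optimal := by linarith
  have hc := hg.pos
  have hb := Bandit.β_pos Δ
  refine ⟨Bandit.integrable_regret hW hlt g htie, ?_, Bandit.bound_const_le hpos hg⟩
  by_cases htop : Bandit.bound c Δ g = ⊤
  · rw [htop]
    exact le_top
  have hs := Bandit.summable_of_bound_ne_top (by positivity) htop
  have hreach : Summable (Bandit.reachProb P g W) :=
    Bandit.summable_reachProb hW hlt hg (by rwa [← hΔ])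
  refine le_trans ?_ (EReal.coe_ennreal_le_coe_ennreal_iff.2 (Bandit.le_bound hpos hg hs))
  rw [EReal.coe_ennreal_ofReal, max_eq_left (by positivity)]
  refine limsup_le_of_le (by isBoundedDefault) ?_
  set K := Δ * (Bandit.epochConst * ∑' e, Bandit.reachProb P g W e) with hK
  have hlog : Tendsto (fun n : ℕ => Real.log n) atTop atTop :=
    Real.tendsto_log_atTop.comp tendsto_natCast_atTop_atTop
  -- For large `n` the constant `K` is at most `8 / (Δ β) * log n`, the spare half of the bound.
  filter_upwards [hlog.eventually_ge_atTop (K / (8 / (Δ * Bandit.β Δ))),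
    hlog.eventually_gt_atTop 0] with n hn hn0
  rw [EReal.coe_le_coe_iff, div_le_iff₀ hn0]
  have h := Bandit.integral_regret_le (g := g) hW hlt htie hreach n
  rw [← hΔ, ← hK] at h
  rw [div_le_iff₀ (by positivity)] at hn
  have : 16 / (Δ * Bandit.β Δ) = 8 / (Δ * Bandit.β Δ) + 8 / (Δ * Bandit.β Δ) := by ring
  rw [this]
  linarith
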